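/- Let $M$ be a matroid on a finite ground set $S$ (possibly empty). Its base polytope is $P_M=\operatorname{conv}\{\mathbf e_B=\sum_{x\in B}\mathbf e_x : B \text{ a basis of } M\}\subset\mathbb R^S$; for $S'\subseteq S$ we regard $P_{M|S'}$ as a polytope in $\mathbb R^{S}$ via $\mathbb R^{S'}\subseteq\mathbb R^S$. The connected components $S_1,\dots,S_r$ of $M$ are the equivalence classes of the relation "$x=y$, or $x$ and $y$ lie in a common circuit" on $S$, and $M$ is connected if any two elements of $S$ are equivalent (so the empty matroid is connected). Let $r'$ be the number of components that do not consist of a single loop or coloop; in particular $r'=r$ if $M$ has neither loops nor coloops. A polytope $Q$ is a deformation of a polytope $P$ if $P=\lambda Q+R$ (Minkowski sum) for some $\lambda>0$ and some polytope $R$. A polytope $P$ is indecomposable if all its deformations have the form $\lambda P+t$ with $\lambda\ge 0$ and $t$ a vector (where $0P$ is the origin). The deformation cone of $P\subset\mathbb R^d$, with vertex set $V(P)$ and edge set $E(P)$, is the cone in $\mathbb R^{E(P)}$ of all vectors $\lambda\ge 0$ for which there is a map $\psi:V(P)\to\mathbb R^d$ with $\psi(v)-\psi(u)=\lambda_{uv}(v-u)$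 for every edge $uv$ of $P$. A cone is simplicial if it is generated by finitely many linearly independent vectors. Two polytopes are normally equivalent if they have the same normal fan. Theorem. 1. If $M$ is connected, then $P_M$ is indecomposable. 2. $P_M$ is indecomposable if and only if $M$ stripped of its loops and coloops is connected. 3. The deformation cone of $P_M$ is a simplicial cone of dimension $r'$. 4. $P_M=P_{M|S_1}+\dots+P_{M|S_r}$, where every $P_{M|S_j}$ is indecomposable, and it is a single point exactly when $S_j$ consists of a loop or a coloop. This decomposition is unique up to translations and single-point summands: if $P_M=R_1+\dots+R_n$ where the $R_i$ are indecomposable polytopes, none of them a single point, and $R_i$ is not of the form $\lambda R_j+t$ with $\lambda>0$ for $i\neq j$, then there is a bijection from $\{1,\dots,n\}$ to the $r'$ components that are not a loop or a coloop such that each $R_i$ is a translate of $P_{M|S_j}$, where $S_j$ is the component corresponding to $i$. 5. Every deformation of $P_M$ is normally equivalent to $\sum_{j\in A}P_{M|S_j}$ for some $A\subseteq\{1,\dots,r\}$ (the empty sum being the origin). -/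

import Mathlib

open scoped Pointwise

noncomputable section

namespace MatroidPolytopes

section Polytopes

variable {V : Type*} [AddCommGroup V] [Module ℝ V]

/-- A (nonempty) polytope: the convex hull of finitely many points. -/
def IsPolytope (P : Set V) : Prop :=
  ∃ s : Set V, s.Finite ∧ s.Nonempty ∧ P = convexHull ℝ s

/-- `Q` is a deformation (weak Minkowski summand) of `P`: `P = l • Q + R` for some
polytope `R` and some real number `l > 0`. -/
def IsDeformation (Q P : Set V) : Prop :=
  IsPolytope Q ∧ ∃ R : Set V, IsPolytope R ∧ ∃ l : ℝ, 0 < l ∧ P = l • Q + R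

/-- A polytope is indecomposable if all its deformations are of the form `l • P + t`
with `l ≥ 0` and `t` a vector. -/
def IsIndecomposable (P : Set V) : Prop :=
  IsPolytope P ∧
    ∀ Q : Set V, IsDeformation Q P → ∃ l : ℝ, 0 ≤ l ∧ ∃ t : V, Q = l • P + {t}

/-- The face of `P` on which the linear functional `c` is maximal. -/
def face (P : Set V) (c : Module.Dual ℝ V) : Set V :=
  {x | x ∈ P ∧ ∀ y ∈ P, c y ≤ c x}

/-- The vertices of `P`: the points that form a face. -/
def vertexSet (P : Set V) : Set V :=
  {v | ∃ c : Module.Dual ℝ V, face P c = {v}}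

/-- The graph of `P`: two distinct vertices are adjacent when the segment between them is
a face (an edge) of `P`. Together with the inclusion of the vertices in the
ambient space, this is the framework of `P`. -/
def polytopeGraph (P : Set V) : SimpleGraph (vertexSet P) where
  Adj p q := p ≠ q ∧ ∃ c : Module.Dual ℝ V, face P c = segment ℝ (p : V) (q : V)
  symm := ⟨fun _ _ h => ⟨h.1.symm, h.2.imp fun _ hc => hc.trans (segment_symm ℝ _ _)⟩⟩
  loopless := ⟨fun _ h => h.1 rfl⟩

/-- The normal fan of `P`: the set of the normal cones of its nonempty faces, where the
normal cone of a face `F` consists of the functionals that are maximal on all of `F`. -/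
def normalFan (P : Set V) : Set (Set (Module.Dual ℝ V)) :=
  {N | ∃ c : Module.Dual ℝ V, N = {d | face P c ⊆ face P d}}

/-- Two polytopes are normally equivalent if they have the same normal fan. -/
def NormallyEquivalent (P Q : Set V) : Prop :=
  normalFan P = normalFan Q

/-- The edge-deformation cone of the framework with graph `G` and realization `φ`: the set of
edge-deformation vectors of all its deformations `ψ`. The coordinate at a nondegenerate
edge `uv` is the ratio `(ψ v - ψ u) / (φ v - φ u)`, a nonnegative real; the coordinate at a
degenerate edge is `0`. -/
def edgeDeformationCone {N : Type*} (G : SimpleGraph N) (φ : N → V) :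
    PointedCone ℝ (G.edgeSet → ℝ) where
  carrier := {l | ∃ ψ : N → V, ∀ (u v : N) (h : G.Adj u v),
    0 ≤ l ⟨s(u, v), G.mem_edgeSet.2 h⟩ ∧
    ψ v - ψ u = l ⟨s(u, v), G.mem_edgeSet.2 h⟩ • (φ v - φ u) ∧
    (φ u = φ v → l ⟨s(u, v), G.mem_edgeSet.2 h⟩ = 0)}
  add_mem' := by
    rintro l m ⟨ψ, hψ⟩ ⟨ω, hω⟩
    refine ⟨ψ + ω, fun u v h => ?_⟩
    obtain ⟨h1, h2, h3⟩ := hψ u v h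
    obtain ⟨k1, k2, k3⟩ := hω u v h
    refine ⟨add_nonneg h1 k1, ?_, fun e => ?_⟩
    · rw [Pi.add_apply, Pi.add_apply, Pi.add_apply, add_smul, ← h2, ← k2]
      abel
    · rw [Pi.add_apply, h3 e, k3 e, add_zero]
  zero_mem' := ⟨0, fun u v h => by simp⟩
  smul_mem' := by
    rintro c l ⟨ψ, hψ⟩
    refine ⟨fun v => (c : ℝ) • ψ v, fun u v h => ?_⟩
    obtain ⟨h1, h2, h3⟩ := hψ u v h
    refine ⟨mul_nonneg c.2 h1, ?_, fun e => ?_⟩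
    · rw [← smul_sub, h2, smul_smul]
      rfl
    · rw [Pi.smul_apply, h3 e, smul_zero]

/-- The deformation cone of the polytope `P`: the edge-deformation cone of its framework. -/
def deformationCone (P : Set V) : PointedCone ℝ ((polytopeGraph P).edgeSet → ℝ) :=
  edgeDeformationCone (polytopeGraph P) (fun v => (v : V))

end Polytopes

/-- The dimension of a cone: the dimension of its linear span. -/
def coneDim {W : Type*} [AddCommGroup W] [Module ℝ W] (C : PointedCone ℝ W) : ℕ :=
  Module.finrank ℝ (Submodule.span ℝ (C : Set W))

section Matroids

variable {α : Type*}

/-- The base polytope of `M`: the convex hull of the indicator vectors of the bases. -/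
def basePolytope (M : Matroid α) : Set (α → ℝ) :=
  convexHull ℝ {x | ∃ B : Set α, M.IsBase B ∧ x = B.indicator 1}

/-- Two elements are related if they are equal or lie in a common circuit. -/
def InCommonCircuit (M : Matroid α) (x y : α) : Prop :=
  x = y ∨ ∃ C : Set α, M.IsCircuit C ∧ x ∈ C ∧ y ∈ C

/-- The connected components of `M`: the classes of `InCommonCircuit M` on the ground set. -/
def components (M : Matroid α) : Set (Set α) :=
  {S | ∃ x ∈ M.E, S = {y | y ∈ M.E ∧ InCommonCircuit M x y}}

/-- A matroid is connected if any two elements of its ground set are in the same component. -/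
def IsConnected (M : Matroid α) : Prop :=
  ∀ x ∈ M.E, ∀ y ∈ M.E, InCommonCircuit M x y

/-- `M` stripped of its loops and coloops. -/
def strip (M : Matroid α) : Matroid α :=
  M.delete (M.loops ∪ M.coloops)

/-- The connected components of `M` that do not consist of a loop or a coloop. -/
def nontrivialComponents (M : Matroid α) : Set (Set α) :=
  {S | S ∈ components M ∧ ∀ x ∈ S, ¬ M.IsLoop x ∧ ¬ M.IsColoop x}

end Matroids

end MatroidPolytopes

end

/-! Everything follows from one description: up to translation, the deformations of `basePolytope M`
are the polytopes `scaledPolytope M μ`, where the nonnegative weight `μ` is constant on components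
and rescales coordinates.

A deformation moves each vertex so that every edge is only stretched, and basis exchanges give edges
in direction `e_y - e_x`. So coordinate `z` changes only in exchanges involving `z`. Bases that
agree about `z` are linked by exchanges not involving `z` (`eq_of_exchange_invariant`), so the new
coordinate depends only on whether `z ∈ B`; the difference of its two values is `μ z`. One exchange
stretches coordinates `x` and `y` equally, so `μ` is constant along circuits
(`exists_weight_of_exchange`, `IsDeformation.exists_weight`).

Conversely, bases can be mixed component by component (`isBase_mix`), which makes `μ ↦
scaledPolytope M μ` additive on weights (`scaledPolytope_add`). The width in an essential direction
recovers `μ` (`weight_eq_of_scaledPolytope_eq`). Hence deformations modulo translation form an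
orthant with one coordinate per nontrivial component. Indecomposability, the unique decomposition,
the simplicial cone and the normal equivalence classes can all be read off from it. -/

namespace MatroidPolytopes

open Set

/-! ### Circuits, components and basis exchange. -/

section MatroidLemmas

variable {α : Type*} {M : Matroid α}

lemma InCommonCircuit.refl (x : α) : InCommonCircuit M x x := Or.inl rfl

lemma InCommonCircuit.symm {x y : α} (h : InCommonCircuit M x y) : InCommonCircuit M y x := by
  rcases h with h | ⟨C, hC, hx, hy⟩
  exacts [Or.inl h.symm, Or.inr ⟨C, hC, hy, hx⟩]

/-- Induction on the size of `C ∪ D`. Strong elimination of a common element `y` gives `K` through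
`x` and `L` through `z`. Either `K ∪ D` is smaller than `C ∪ D`, or `K` contains all of `C \ D` and
therefore meets `L`, while `K ∪ L` misses `y`. -/
lemma exists_isCircuit_of_inter_nonempty [Finite α] {C D : Set α} {x z : α} (hC : M.IsCircuit C)
    (hD : M.IsCircuit D) (hx : x ∈ C) (hz : z ∈ D) (hCD : (C ∩ D).Nonempty) :
    ∃ K, M.IsCircuit K ∧ x ∈ K ∧ z ∈ K := by
  induction hn : (C ∪ D).ncard using Nat.strong_induction_on generalizing C D with
  | _ n ih =>
  subst hn
  by_cases hxD : x ∈ D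
  · exact ⟨D, hD, hxD, hz⟩
  by_cases hzC : z ∈ C
  · exact ⟨C, hC, hx, hzC⟩
  obtain ⟨y, hyC, hyD⟩ := hCD
  obtain ⟨K, hKs, hK, hxK⟩ := hC.strong_elimination hD hyC hyD hx hxD
  obtain ⟨L, hLs, hL, hzL⟩ := hD.strong_elimination hC hyD hyC hz hzC
  have hKD : (K ∩ D).Nonempty := by
    by_contra h
    have hKC : K ⊆ C := fun w hw => (hKs hw).1.resolve_right fun hwD => h ⟨w, hw, hwD⟩
    have := hK.eq_of_subset_isCircuit hC hKC
    exact (hKs (this ▸ hyC)).2 rfl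
  by_cases hlt : K ∪ D ⊂ C ∪ D
  · exact ih _ (ncard_lt_ncard hlt) hK hD hxK hz hKD rfl
  have hsub : C ∪ D ⊆ K ∪ D := by
    by_contra h
    exact hlt ⟨union_subset (fun w hw => (hKs hw).1) subset_union_right, h⟩
  have hLD : ∃ w ∈ L, w ∉ D := by
    by_contra! h
    have := hL.eq_of_subset_isCircuit hD h
    exact (hLs (this ▸ hyD)).2 rfl
  obtain ⟨w, hwL, hwD⟩ := hLD
  have hwK : w ∈ K := (hsub (Or.inl ((hLs hwL).1.resolve_left hwD))).resolve_right hwD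
  refine ih _ (ncard_lt_ncard ⟨union_subset (fun w hw => (hKs hw).1)
    fun w hw => (hLs hw).1.symm, fun h => ?_⟩) hK hL hxK hzL ⟨w, hwK, hwL⟩ rfl
  rcases h (Or.inl hyC) with h | h
  exacts [(hKs h).2 rfl, (hLs h).2 rfl]

lemma InCommonCircuit.trans [Finite α] {x y z : α} (hxy : InCommonCircuit M x y)
    (hyz : InCommonCircuit M y z) : InCommonCircuit M x z := by
  rcases hxy with rfl | ⟨C, hC, hx, hy⟩
  · exact hyz
  rcases hyz with rfl | ⟨D, hD, hy', hz⟩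
  · exact Or.inr ⟨C, hC, hx, hy⟩
  exact Or.inr (exists_isCircuit_of_inter_nonempty hC hD hx hz ⟨y, hy, hy'⟩)

/-- An element contained in some basis but not in all, that is, an element of the ground set
that is neither a loop nor a coloop. -/
def IsEssential (M : Matroid α) (z : α) : Prop :=
  (∃ B, M.IsBase B ∧ z ∈ B) ∧ ∃ B, M.IsBase B ∧ z ∉ B

lemma IsEssential.mem_ground {z : α} (hz : IsEssential M z) : z ∈ M.E := by
  obtain ⟨⟨B, hB, hz⟩, -⟩ := hz
  exact hB.subset_ground hz

lemma isEssential_iff {z : α} (hz : z ∈ M.E) :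
    IsEssential M z ↔ ¬ M.IsLoop z ∧ ¬ M.IsColoop z := by
  rw [Matroid.isLoop_iff_forall_notMem_isBase, Matroid.isColoop_iff_forall_mem_isBase]
  simp [IsEssential]

/-- Once `C \ {y}` is extended to a basis, `C` is the fundamental circuit of `y`, so each of its
other elements can be swapped for `y`. -/
lemma exists_exchange_of_isCircuit {C : Set α} (hC : M.IsCircuit C) {x y : α} (hx : x ∈ C)
    (hy : y ∈ C) (hxy : x ≠ y) :
    ∃ B, M.IsBase B ∧ x ∈ B ∧ y ∉ B ∧ M.IsBase (insert y (B \ {x})) := by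
  obtain ⟨B, hB, hCB⟩ := (hC.sdiff_singleton_indep hy).exists_isBase_superset
  have hxB : x ∈ B := hCB ⟨hx, hxy⟩
  have hCi : C ⊆ insert y B := fun w hw => by
    by_cases h : w = y
    exacts [Or.inl h, Or.inr (hCB ⟨hw, h⟩)]
  have hyB : y ∉ B := fun h => hC.not_indep (hB.indep.subset (hCi.trans (by simp [h])))
  refine ⟨B, hB, hxB, hyB, ?_⟩
  have hyE := hC.subset_ground hy
  apply hB.exchange_isBase_of_indep hyB
  rw [insert_sdiff_singleton_comm hxy.symm,
    ← hB.indep.mem_fundCircuit_iff (by rwa [hB.closure_eq]) hyB,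
    ← hC.eq_fundCircuit_of_subset hB.indep hCi]
  exact hx

lemma inCommonCircuit_of_exchange {B : Set α} {x y : α} (hB : M.IsBase B) (hy : y ∉ B)
    (h : M.IsBase (insert y (B \ {x}))) : InCommonCircuit M x y := by
  by_cases hxy : x = y
  · exact Or.inl hxy
  have hyE : y ∈ M.E := h.subset_ground (mem_insert _ _)
  refine Or.inr ⟨M.fundCircuit y B, hB.fundCircuit_isCircuit hyE hy, ?_, M.mem_fundCircuit y B⟩
  rw [hB.indep.mem_fundCircuit_iff (by rwa [hB.closure_eq]) hy,
    ← insert_sdiff_singleton_comm (Ne.symm hxy)]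
  exact h.indep

lemma isEssential_of_isCircuit {C : Set α} (hC : M.IsCircuit C) {x y : α} (hx : x ∈ C)
    (hy : y ∈ C) (hxy : x ≠ y) : IsEssential M x := by
  obtain ⟨B, hB, hxB, hyB, hB'⟩ := exists_exchange_of_isCircuit hC hx hy hxy
  exact ⟨⟨B, hB, hxB⟩, ⟨_, hB', by simp [hxy]⟩⟩

lemma InCommonCircuit.eq_or_isEssential {x y : α} (h : InCommonCircuit M x y) :
    x = y ∨ (IsEssential M x ∧ IsEssential M y) := by
  by_cases hxy : x = y
  · exact Or.inl hxy
  obtain ⟨C, hC, hx, hy⟩ := h.resolve_left hxy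
  exact Or.inr ⟨isEssential_of_isCircuit hC hx hy hxy,
    isEssential_of_isCircuit hC hy hx (Ne.symm hxy)⟩

lemma InCommonCircuit.mem_ground {x y : α} (h : InCommonCircuit M x y) (hx : x ∈ M.E) :
    y ∈ M.E := by
  rcases h with rfl | ⟨C, hC, -, hy⟩
  exacts [hx, hC.subset_ground hy]

/-- A function on the bases that is unchanged by all exchanges not involving `z` only depends on
whether a basis contains `z`. -/
lemma eq_of_exchange_invariant [Finite α] {β : Type*} {z : α} (f : Set α → β)
    (hf : ∀ B x y, M.IsBase B → x ∈ B → y ∉ B → M.IsBase (insert y (B \ {x})) → z ≠ x → z ≠ y →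
      f (insert y (B \ {x})) = f B)
    {B B' : Set α} (hB : M.IsBase B) (hB' : M.IsBase B') (hz : z ∈ B ↔ z ∈ B') : f B = f B' := by
  induction hn : (B \ B').ncard using Nat.strong_induction_on generalizing B with
  | _ n ih =>
  subst hn
  by_cases hBB : B ⊆ B'
  · rw [hB.eq_of_subset_isBase hB' hBB]
  obtain ⟨x, hxB, hxB'⟩ := not_subset.1 hBB
  obtain ⟨y, ⟨hyB', hyB⟩, hby⟩ := hB.exchange hB' ⟨hxB, hxB'⟩
  -- The exchange removes an element outside `B'` and adds one of `B'`; since `B` and `B'` agree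
  -- about `z`, it cannot involve `z`.
  have hzx : z ≠ x := fun h => hxB' (h ▸ hz.1 (h ▸ hxB))
  have hzy : z ≠ y := fun h => hyB (h ▸ hz.2 (h ▸ hyB'))
  rw [← hf B x y hB hxB hyB hby hzx hzy]
  refine ih _ (ncard_lt_ncard ⟨?_, fun h => ?_⟩) hby (by simp [hzx, hzy, hz]) rfl
  · rintro w ⟨rfl | hw, hw'⟩
    exacts [absurd hyB' hw', ⟨hw.1, hw'⟩]
  · rcases (h ⟨hxB, hxB'⟩).1 with h | h
    exacts [hyB (h ▸ hxB), h.2 rfl]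

/-- No circuit crosses the boundary of `S`. A circuit in the mixed set would thus lie in `B` or in
`B'`; and the fundamental circuit of a new element stays on its side of `S`, which gives maximality.
-/
lemma isBase_mix {S : Set α} (hS : ∀ x ∈ S, ∀ y, InCommonCircuit M x y → y ∈ S)
    {B B' : Set α} (hB : M.IsBase B) (hB' : M.IsBase B') : M.IsBase (B' ∩ S ∪ B \ S) := by
  have hC : ∀ C, M.IsCircuit C → C ⊆ S ∨ Disjoint C S := by
    intro C hC
    by_cases h : Disjoint C S
    · exact Or.inr h
    obtain ⟨x, hxC, hxS⟩ := not_disjoint_iff.1 h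
    exact Or.inl fun y hy => hS x hxS y (Or.inr ⟨C, hC, hxC, hy⟩)
  have hE : B' ∩ S ∪ B \ S ⊆ M.E :=
    union_subset (inter_subset_left.trans hB'.subset_ground) (sdiff_subset.trans hB.subset_ground)
  refine Matroid.Indep.isBase_of_forall_insert ?_ ?_
  · rw [Matroid.indep_iff_forall_subset_not_isCircuit hE]
    intro C hCs hCc
    rcases hC C hCc with h | h
    · refine hCc.not_indep (hB'.indep.subset fun x hx => ?_)
      rcases hCs hx with h' | h'
      exacts [h'.1, absurd (h hx) h'.2]
    · refine hCc.not_indep (hB.indep.subset fun x hx => ?_)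
      rcases hCs hx with h' | h'
      exacts [absurd h'.2 (disjoint_left.1 h hx), h'.1]
  · rintro e ⟨heE, he⟩ hi
    by_cases heS : e ∈ S
    · have heB : e ∉ B' := fun h => he (Or.inl ⟨h, heS⟩)
      have hc := hB'.fundCircuit_isCircuit heE heB
      have hcS := (hC _ hc).resolve_right
        (not_disjoint_iff.2 ⟨e, M.mem_fundCircuit e B', heS⟩)
      refine hc.not_indep (hi.subset fun w hw => ?_)
      rcases M.fundCircuit_subset_insert e B' hw with h | h
      exacts [Or.inl h, Or.inr (Or.inl ⟨h, hcS hw⟩)]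
    · have heB : e ∉ B := fun h => he (Or.inr ⟨h, heS⟩)
      have hc := hB.fundCircuit_isCircuit heE heB
      have hcS := (hC _ hc).resolve_left fun h => heS (h (M.mem_fundCircuit e B))
      refine hc.not_indep (hi.subset fun w hw => ?_)
      rcases M.fundCircuit_subset_insert e B hw with h | h
      exacts [Or.inl h, Or.inr (Or.inr ⟨h, disjoint_left.1 hcS hw⟩)]

lemma restrict_isBase_iff_of_closed {S : Set α}
    (hS : ∀ x ∈ S, ∀ y, InCommonCircuit M x y → y ∈ S) (hSE : S ⊆ M.E) {I : Set α} :
    (M.restrict S).IsBase I ↔ ∃ B, M.IsBase B ∧ I = B ∩ S := by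
  rw [Matroid.isBase_restrict_iff hSE]
  refine ⟨fun h => h.exists_isBase, ?_⟩
  rintro ⟨B, hB, rfl⟩
  refine (hB.indep.inter_right S).isBasis_of_forall_insert inter_subset_right ?_
  rintro e ⟨heS, he⟩
  have heB : e ∉ B := fun h => he ⟨h, heS⟩
  have hc := hB.fundCircuit_isCircuit (hSE heS) heB
  refine hc.dep.superset (fun w hw => ?_)
    (insert_subset (hSE heS) (inter_subset_left.trans hB.subset_ground))
  rcases M.fundCircuit_subset_insert e B hw with h | h
  · exact Or.inl h
  · exact Or.inr ⟨h, hS e heS w (Or.inr ⟨_, hc, M.mem_fundCircuit e B, hw⟩)⟩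

/-- A circuit with two distinct elements contains neither loops nor coloops, so it survives the
stripping. -/
lemma strip_isConnected_iff :
    IsConnected (strip M) ↔
      ∀ x y, IsEssential M x → IsEssential M y → InCommonCircuit M x y := by
  have hg : ∀ x, x ∈ (strip M).E ↔ IsEssential M x := by
    intro x
    have : x ∈ (strip M).E ↔ x ∈ M.E ∧ ¬ M.IsLoop x ∧ ¬ M.IsColoop x := by
      simp [strip, Matroid.isLoop_iff, Matroid.isColoop_iff_mem_coloops]
    rw [this]
    exact ⟨fun h => (isEssential_iff h.1).2 h.2, fun h => ⟨h.mem_ground,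
      (isEssential_iff h.mem_ground).1 h⟩⟩
  have hcc : ∀ x y, InCommonCircuit (strip M) x y ↔ InCommonCircuit M x y := by
    intro x y
    by_cases hxy : x = y
    · simp [InCommonCircuit, hxy]
    simp only [InCommonCircuit, hxy, false_or]
    refine exists_congr fun C => ?_
    rw [strip, Matroid.delete_isCircuit_iff]
    refine ⟨fun h => ⟨h.1.1, h.2⟩, fun h => ⟨⟨h.1, disjoint_left.2 fun w hw => ?_⟩, h.2⟩⟩
    have : IsEssential M w := by
      by_cases hwx : w = x
      · exact isEssential_of_isCircuit h.1 hw h.2.2 (hwx ▸ hxy)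
      · exact isEssential_of_isCircuit h.1 hw h.2.1 hwx
    have := (isEssential_iff this.mem_ground).1 this
    rintro (hl | hl)
    exacts [this.1 hl, this.2 hl]
  refine ⟨fun h x y hx hy => (hcc x y).1 (h x ((hg x).2 hx) y ((hg y).2 hy)),
    fun h x hx y hy => (hcc x y).2 (h x y ((hg x).1 hx) ((hg y).1 hy))⟩

end MatroidLemmas

/-! ### Images and Minkowski sums of polytopes. -/

section PolytopeLemmas

variable {V W : Type*} [AddCommGroup V] [Module ℝ V] [AddCommGroup W] [Module ℝ W]

lemma IsPolytope.image {P : Set V} (hP : IsPolytope P) (f : V →ₗ[ℝ] W) : IsPolytope (f '' P) := by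
  obtain ⟨s, hs, hne, rfl⟩ := hP
  exact ⟨f '' s, hs.image f, hne.image f, f.image_convexHull s⟩

lemma IsPolytope.add {P Q : Set V} (hP : IsPolytope P) (hQ : IsPolytope Q) :
    IsPolytope (P + Q) := by
  obtain ⟨s, hs, hne, rfl⟩ := hP
  obtain ⟨t, ht, hne', rfl⟩ := hQ
  exact ⟨s + t, hs.add ht, hne.add hne', (convexHull_add s t).symm⟩

lemma isPolytope_singleton (v : V) : IsPolytope ({v} : Set V) :=
  ⟨{v}, finite_singleton v, singleton_nonempty v, (convexHull_singleton v).symm⟩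

lemma IsPolytope.sum {ι : Type*} (s : Finset ι) {P : ι → Set V} (hP : ∀ i ∈ s, IsPolytope (P i)) :
    IsPolytope (∑ i ∈ s, P i) := by
  classical
  induction s using Finset.induction_on with
  | empty => exact isPolytope_singleton (0 : V)
  | insert i s hi ih =>
    rw [Finset.sum_insert hi]
    exact (hP i (by simp)).add (ih fun j hj => hP j (by simp [hj]))

end PolytopeLemmas

/-! ### Rescaled base polytopes and their Minkowski sums. -/

section Weights

variable {α : Type*} {M : Matroid α} {μ ν : α → ℝ}

lemma indicator_mem_basePolytope {B : Set α} (hB : M.IsBase B) :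
    B.indicator (1 : α → ℝ) ∈ basePolytope M :=
  subset_convexHull ℝ _ ⟨B, hB, rfl⟩

lemma basePolytope_nonempty : (basePolytope M).Nonempty := by
  obtain ⟨B, hB⟩ := M.exists_isBase
  exact ⟨_, indicator_mem_basePolytope hB⟩

lemma isPolytope_basePolytope [Finite α] (M : Matroid α) : IsPolytope (basePolytope M) := by
  refine ⟨_, ?_, convexHull_nonempty_iff.1 basePolytope_nonempty, rfl⟩
  refine (Set.finite_range fun B : Set α => B.indicator (1 : α → ℝ)).subset ?_
  rintro x ⟨B, -, rfl⟩
  exact ⟨B, rfl⟩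

lemma basePolytope_subset_of_convex {C : Set (α → ℝ)} (hC : Convex ℝ C)
    (h : ∀ B, M.IsBase B → B.indicator 1 ∈ C) : basePolytope M ⊆ C := by
  refine convexHull_min ?_ hC
  rintro x ⟨B, hB, rfl⟩
  exact h B hB

lemma mem_basePolytope_apply_mem {v : α → ℝ} (hv : v ∈ basePolytope M) {z : α} {I : Set ℝ}
    (hI : Convex ℝ I) (h : ∀ B, M.IsBase B → B.indicator (1 : α → ℝ) z ∈ I) : v z ∈ I :=
  basePolytope_subset_of_convex (C := (fun u : α → ℝ => u z) ⁻¹' I)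
    (hI.linear_preimage (LinearMap.proj (R := ℝ) (φ := fun _ : α => ℝ) z)) h hv

lemma apply_mem_Icc {v : α → ℝ} (hv : v ∈ basePolytope M) (z : α) : v z ∈ Icc (0 : ℝ) 1 := by
  classical
  refine mem_basePolytope_apply_mem hv (convex_Icc 0 1) fun B _ => ?_
  by_cases h : z ∈ B <;> simp [h]

lemma apply_eq_zero {v : α → ℝ} (hv : v ∈ basePolytope M) {z : α} (hz : z ∉ M.E) : v z = 0 := by
  refine mem_basePolytope_apply_mem hv (convex_singleton (0 : ℝ)) fun B hB => ?_
  exact indicator_of_notMem (fun h => hz (hB.subset_ground h)) _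

lemma apply_eq_of_not_isEssential {v w : α → ℝ} (hv : v ∈ basePolytope M)
    (hw : w ∈ basePolytope M) {z : α} (hz : ¬ IsEssential M z) : v z = w z := by
  refine mem_basePolytope_apply_mem hv (convex_singleton (w z)) fun B hB => ?_
  refine (mem_basePolytope_apply_mem hw (convex_singleton _) fun B' hB' => ?_ :
    w z ∈ ({B.indicator 1 z} : Set ℝ)).symm
  by_cases h : z ∈ B <;> by_cases h' : z ∈ B'
  · simp [h, h']
  · exact absurd ⟨⟨B, hB, h⟩, ⟨B', hB', h'⟩⟩ hz
  · exact absurd ⟨⟨B', hB', h'⟩, ⟨B, hB, h⟩⟩ hz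
  · simp [h, h']

/-- The image of the base polytope under the coordinatewise multiplication with `μ`. -/
def scaledPolytope (M : Matroid α) (μ : α → ℝ) : Set (α → ℝ) :=
  LinearMap.mulLeft ℝ μ '' basePolytope M

lemma mem_scaledPolytope {x : α → ℝ} :
    x ∈ scaledPolytope M μ ↔ ∃ v ∈ basePolytope M, μ * v = x := Iff.rfl

lemma isPolytope_scaledPolytope [Finite α] (M : Matroid α) (μ : α → ℝ) :
    IsPolytope (scaledPolytope M μ) :=
  (isPolytope_basePolytope M).image _

lemma smul_scaledPolytope (l : ℝ) : l • scaledPolytope M μ = scaledPolytope M (l • μ) := by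
  ext x
  simp only [mem_smul_set, mem_scaledPolytope]
  constructor
  · rintro ⟨_, ⟨v, hv, rfl⟩, rfl⟩
    exact ⟨v, hv, smul_mul_assoc _ _ _⟩
  · rintro ⟨v, hv, rfl⟩
    exact ⟨_, ⟨v, hv, rfl⟩, (smul_mul_assoc _ _ _).symm⟩

lemma scaledPolytope_zero : scaledPolytope M 0 = 0 := by
  ext x
  simp only [mem_scaledPolytope, zero_mul, Set.mem_zero]
  exact ⟨fun ⟨_, _, h⟩ => h.symm, fun h => ⟨_, basePolytope_nonempty.some_mem, h.symm⟩⟩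

lemma scaledPolytope_indicator_ground : scaledPolytope M (M.E.indicator 1) = basePolytope M := by
  refine (image_congr fun v hv => ?_ : _ = id '' _).trans (image_id _)
  ext z
  by_cases hz : z ∈ M.E
  · simp [hz]
  · simp [hz, apply_eq_zero hv hz]

/-- Nonessential coordinates are constant on the base polytope, so changing the weight there only
translates. -/
lemma exists_scaledPolytope_eq_add (h : ∀ z, IsEssential M z → μ z = ν z) :
    ∃ t, scaledPolytope M μ = scaledPolytope M ν + {t} := by
  obtain ⟨w, hw⟩ := basePolytope_nonempty (M := M)
  have key : ∀ v ∈ basePolytope M, μ * v = ν * v + (μ - ν) * w := by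
    intro v hv
    ext z
    by_cases hz : IsEssential M z
    · simp [h z hz]
    · simp [apply_eq_of_not_isEssential hv hw hz]
      ring
  refine ⟨(μ - ν) * w, ?_⟩
  rw [add_singleton, scaledPolytope, scaledPolytope, image_image]
  exact image_congr key

/-- The width in direction `z` is translation invariant; this is what makes the weight recoverable
from the polytope. -/
lemma exists_width_eq (hμ : ∀ z, 0 ≤ μ z) {z : α} (hz : IsEssential M z) (t : α → ℝ) :
    (∃ v ∈ scaledPolytope M μ + {t}, ∃ w ∈ scaledPolytope M μ + {t}, v z - w z = μ z) ∧
    ∀ v ∈ scaledPolytope M μ + {t}, ∀ w ∈ scaledPolytope M μ + {t}, v z - w z ≤ μ z := by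
  simp only [add_singleton]
  constructor
  · obtain ⟨⟨B, hB, hzB⟩, ⟨B', hB', hzB'⟩⟩ := hz
    refine ⟨_, ⟨_, ⟨_, indicator_mem_basePolytope hB, rfl⟩, rfl⟩,
      _, ⟨_, ⟨_, indicator_mem_basePolytope hB', rfl⟩, rfl⟩, ?_⟩
    simp [hzB, hzB']
  · rintro _ ⟨_, ⟨v, hv, rfl⟩, rfl⟩ _ ⟨_, ⟨w, hw, rfl⟩, rfl⟩
    have h1 := apply_mem_Icc hv z
    have h2 := apply_mem_Icc hw z
    simp only [LinearMap.mulLeft_apply, Pi.add_apply, Pi.mul_apply]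
    nlinarith [hμ z, h1.1, h1.2, h2.1, h2.2]

lemma weight_eq_of_scaledPolytope_eq (hμ : ∀ z, 0 ≤ μ z) (hν : ∀ z, 0 ≤ ν z) {s t : α → ℝ}
    (h : scaledPolytope M μ + {s} = scaledPolytope M ν + {t}) {z : α} (hz : IsEssential M z) :
    μ z = ν z := by
  obtain ⟨⟨v, hv, w, hw, h1⟩, h2⟩ := exists_width_eq hμ hz s
  obtain ⟨⟨v', hv', w', hw', h1'⟩, h2'⟩ := exists_width_eq hν hz t
  rw [h] at hv hw h2
  exact le_antisymm (h1 ▸ h2' v hv w hw) (h1' ▸ h2 v' hv' w' hw')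

/-- The nonnegative functions on the ground set that are constant on every component. -/
structure IsWeight (M : Matroid α) (μ : α → ℝ) : Prop where
  nonneg : ∀ z, 0 ≤ μ z
  eq_zero : ∀ z, z ∉ M.E → μ z = 0
  congr : ∀ x y, InCommonCircuit M x y → μ x = μ y

lemma IsWeight.zero : IsWeight M 0 := ⟨fun _ => le_rfl, fun _ _ => rfl, fun _ _ _ => rfl⟩

lemma IsWeight.add (hμ : IsWeight M μ) (hν : IsWeight M ν) : IsWeight M (μ + ν) where
  nonneg z := add_nonneg (hμ.nonneg z) (hν.nonneg z)
  eq_zero z hz := by simp [hμ.eq_zero z hz, hν.eq_zero z hz]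
  congr x y h := by simp [hμ.congr x y h, hν.congr x y h]

lemma IsWeight.smul (hμ : IsWeight M μ) {l : ℝ} (hl : 0 ≤ l) : IsWeight M (l • μ) where
  nonneg z := mul_nonneg hl (hμ.nonneg z)
  eq_zero z hz := by simp [hμ.eq_zero z hz]
  congr x y h := by simp [hμ.congr x y h]

lemma IsWeight.mul (hμ : IsWeight M μ) (hν : IsWeight M ν) : IsWeight M (μ * ν) where
  nonneg z := mul_nonneg (hμ.nonneg z) (hν.nonneg z)
  eq_zero z hz := by simp [hμ.eq_zero z hz]
  congr x y h := by simp [hμ.congr x y h, hν.congr x y h]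

lemma IsWeight.sum {ι : Type*} (s : Finset ι) {μ : ι → α → ℝ} (hμ : ∀ i ∈ s, IsWeight M (μ i)) :
    IsWeight M (∑ i ∈ s, μ i) := by
  classical
  induction s using Finset.induction_on with
  | empty => simpa using IsWeight.zero
  | insert i s hi ih =>
    rw [Finset.sum_insert hi]
    exact (hμ i (by simp)).add (ih fun j hj => hμ j (by simp [hj]))

lemma isWeight_indicator {S : Set α} (hSE : S ⊆ M.E)
    (hS : ∀ x ∈ S, ∀ y, InCommonCircuit M x y → y ∈ S) : IsWeight M (S.indicator 1) where
  nonneg z := indicator_nonneg (by simp) z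
  eq_zero z hz := indicator_of_notMem (fun h => hz (hSE h)) _
  congr x y h := by
    have : x ∈ S ↔ y ∈ S := ⟨fun hx => hS x hx y h, fun hy => hS y hy x h.symm⟩
    by_cases hx : x ∈ S
    · simp [hx, this.1 hx]
    · rw [indicator_of_notMem hx, indicator_of_notMem (mt this.2 hx)]

lemma isWeight_indicator_ground : IsWeight M (M.E.indicator 1) :=
  isWeight_indicator subset_rfl fun _ hx _ h => h.mem_ground hx

/-- Mixing is linear in the pair `(w, v)`, so it is enough to mix vertices, which is `isBase_mix`.
-/
lemma mix_mem_basePolytope {S : Set α} (hS : ∀ x ∈ S, ∀ y, InCommonCircuit M x y → y ∈ S)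
    {v w : α → ℝ} (hv : v ∈ basePolytope M) (hw : w ∈ basePolytope M) :
    S.indicator w + Sᶜ.indicator v ∈ basePolytope M := by
  let L : (α → ℝ) × (α → ℝ) →ₗ[ℝ] α → ℝ :=
    (LinearMap.mulLeft ℝ (S.indicator 1)).coprod (LinearMap.mulLeft ℝ (Sᶜ.indicator 1))
  have hL : ∀ p, L p = S.indicator p.1 + Sᶜ.indicator p.2 := by
    intro p
    ext z
    by_cases hz : z ∈ S <;> simp [L, hz]
  have hmem : (w, v) ∈ basePolytope M ×ˢ basePolytope M := ⟨hw, hv⟩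
  rw [basePolytope, ← convexHull_prod] at hmem
  have := mem_image_of_mem L hmem
  rw [hL, L.image_convexHull] at this
  refine convexHull_mono ?_ this
  rintro _ ⟨⟨_, _⟩, ⟨⟨B', hB', h⟩, ⟨B, hB, h'⟩⟩, rfl⟩
  dsimp only at h h'
  subst h h'
  refine ⟨_, isBase_mix hS hB hB', ?_⟩
  rw [hL]
  ext z
  by_cases hz : z ∈ S <;> by_cases h1 : z ∈ B <;> by_cases h2 : z ∈ B' <;> simp [hz, h1, h2]

/-- The base polytope is the product of its component parts: starting from any point, the components
are overwritten one at a time. -/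
lemma mem_basePolytope_of_forall_component [Finite α] {u : α → ℝ}
    (h : ∀ z ∈ M.E, ∃ w ∈ basePolytope M, ∀ y, InCommonCircuit M z y → u y = w y)
    (h0 : ∀ z ∉ M.E, u z = 0) : u ∈ basePolytope M := by
  have key : ∀ T : Set α, T.Finite → T ⊆ M.E → ∃ v ∈ basePolytope M, ∀ z ∈ T, ∀ y,
      InCommonCircuit M z y → v y = u y := by
    intro T hT
    induction T, hT using Set.Finite.induction_on with
    | empty =>
      exact fun _ => ⟨_, basePolytope_nonempty.some_mem, by simp⟩
    | @insert a T ha hT ih =>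
      intro hsub
      obtain ⟨v, hv, hvu⟩ := ih ((subset_insert _ _).trans hsub)
      obtain ⟨w, hw, hwu⟩ := h a (hsub (mem_insert _ _))
      refine ⟨_, mix_mem_basePolytope (S := {y | InCommonCircuit M a y})
        (fun x hx y hxy => InCommonCircuit.trans hx hxy) hv hw, ?_⟩
      intro z hz y hzy
      by_cases hay : InCommonCircuit M a y
      · simp [hay, hwu]
      · rcases hz with rfl | hz
        · exact absurd hzy hay
        · simp [hay, hvu z hz y hzy]
  obtain ⟨v, hv, hvu⟩ := key M.E (toFinite _) subset_rfl
  convert! hv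
  ext z
  by_cases hz : z ∈ M.E
  · exact (hvu z hz z (InCommonCircuit.refl z)).symm
  · rw [h0 z hz, apply_eq_zero hv hz]

lemma scaledPolytope_add [Finite α] (hμ : IsWeight M μ) (hν : IsWeight M ν) :
    scaledPolytope M μ + scaledPolytope M ν = scaledPolytope M (μ + ν) := by
  classical
  apply Subset.antisymm
  · rintro _ ⟨_, ⟨v, hv, rfl⟩, _, ⟨w, hw, rfl⟩, rfl⟩
    -- The average has ratios `μ / (μ + ν)` and `ν / (μ + ν)`, constant on each component. Where
    -- both weights vanish, the value is invisible after scaling, and `v` serves as a filler.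
    refine ⟨fun z => if μ z + ν z = 0 then v z else
      μ z / (μ z + ν z) * v z + ν z / (μ z + ν z) * w z, ?_, ?_⟩
    · refine mem_basePolytope_of_forall_component (fun z _ => ?_) fun z hz => ?_
      · by_cases h0 : μ z + ν z = 0
        · refine ⟨v, hv, fun y hy => ?_⟩
          rw [← hμ.congr z y hy, ← hν.congr z y hy, if_pos h0]
        · refine ⟨(μ z / (μ z + ν z)) • v + (ν z / (μ z + ν z)) • w, ?_, fun y hy => ?_⟩
          · have := add_nonneg (hμ.nonneg z) (hν.nonneg z)
            exact (convex_convexHull ℝ _) hv hw (div_nonneg (hμ.nonneg z) this)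
              (div_nonneg (hν.nonneg z) this) (by rw [← add_div, div_self h0])
          · simp only [← hμ.congr z y hy, ← hν.congr z y hy, if_neg h0]
            rfl
      · simp [apply_eq_zero hv hz, apply_eq_zero hw hz]
    · ext z
      simp only [LinearMap.mulLeft_apply, Pi.mul_apply, Pi.add_apply]
      split_ifs with h0
      · have h1 : μ z = 0 := by linarith [hμ.nonneg z, hν.nonneg z]
        have h2 : ν z = 0 := by linarith
        simp [h1, h2]
      · field_simp
  · rintro _ ⟨v, hv, rfl⟩
    exact ⟨_, ⟨v, hv, rfl⟩, _, ⟨v, hv, rfl⟩, (add_mul μ ν v).symm⟩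

lemma scaledPolytope_sum [Finite α] {ι : Type*} (s : Finset ι) {μ : ι → α → ℝ}
    (hμ : ∀ i ∈ s, IsWeight M (μ i)) :
    ∑ i ∈ s, scaledPolytope M (μ i) = scaledPolytope M (∑ i ∈ s, μ i) := by
  classical
  induction s using Finset.induction_on with
  | empty => simp [scaledPolytope_zero]
  | insert i s hi ih =>
    rw [Finset.sum_insert hi, Finset.sum_insert hi, ih fun j hj => hμ j (by simp [hj]),
      scaledPolytope_add (hμ i (by simp)) (IsWeight.sum s fun j hj => hμ j (by simp [hj]))]

lemma basePolytope_restrict {S : Set α} (hSE : S ⊆ M.E)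
    (hS : ∀ x ∈ S, ∀ y, InCommonCircuit M x y → y ∈ S) :
    basePolytope (M.restrict S) = scaledPolytope M (S.indicator 1) := by
  have h : ∀ B : Set α, LinearMap.mulLeft ℝ (S.indicator 1) (B.indicator (1 : α → ℝ)) =
      (B ∩ S).indicator 1 := by
    intro B
    ext z
    by_cases h1 : z ∈ S <;> by_cases h2 : z ∈ B <;> simp [h1, h2]
  rw [scaledPolytope, basePolytope, basePolytope, LinearMap.image_convexHull]
  congr 1
  ext x
  simp only [restrict_isBase_iff_of_closed hS hSE, mem_image, mem_ofPred_eq]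
  constructor
  · rintro ⟨_, ⟨B, hB, rfl⟩, rfl⟩
    exact ⟨_, ⟨B, hB, rfl⟩, h B⟩
  · rintro ⟨_, ⟨B, hB, rfl⟩, rfl⟩
    exact ⟨_, ⟨B, hB, rfl⟩, h B⟩

lemma component_closed [Finite α] {S : Set α} (hS : S ∈ components M) :
    ∀ x ∈ S, ∀ y, InCommonCircuit M x y → y ∈ S := by
  obtain ⟨a, -, rfl⟩ := hS
  exact fun x hx y hxy => ⟨hxy.mem_ground hx.1, hx.2.trans hxy⟩

lemma component_subset {S : Set α} (hS : S ∈ components M) : S ⊆ M.E := by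
  obtain ⟨a, -, rfl⟩ := hS
  exact fun x hx => hx.1

lemma inCommonCircuit_of_mem_component {S : Set α} [Finite α] (hS : S ∈ components M) {x y : α}
    (hx : x ∈ S) (hy : y ∈ S) : InCommonCircuit M x y := by
  obtain ⟨a, -, rfl⟩ := hS
  exact hx.2.symm.trans hy.2

lemma component_eq_of_mem [Finite α] {S T : Set α} (hS : S ∈ components M)
    (hT : T ∈ components M) {x : α} (hx : x ∈ S) (hx' : x ∈ T) : S = T := by
  ext y
  exact ⟨fun hy => component_closed hT x hx' y (inCommonCircuit_of_mem_component hS hx hy),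
    fun hy => component_closed hS x hx y (inCommonCircuit_of_mem_component hT hx' hy)⟩

/-- The component of an element of the ground set. -/
def componentOf (M : Matroid α) (x : α) : Set α := {y | y ∈ M.E ∧ InCommonCircuit M x y}

lemma componentOf_mem {x : α} (hx : x ∈ M.E) : componentOf M x ∈ components M := ⟨x, hx, rfl⟩

lemma mem_componentOf {x : α} (hx : x ∈ M.E) : x ∈ componentOf M x :=
  ⟨hx, InCommonCircuit.refl x⟩

lemma isWeight_component [Finite α] {S : Set α} (hS : S ∈ components M) :
    IsWeight M (S.indicator 1) :=
  isWeight_indicator (component_subset hS) (component_closed hS)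

lemma mem_nontrivialComponents_iff {S : Set α} :
    S ∈ nontrivialComponents M ↔ S ∈ components M ∧ ∀ x ∈ S, IsEssential M x := by
  refine and_congr_right fun hS => forall₂_congr fun x hx => ?_
  rw [isEssential_iff (component_subset hS hx)]

lemma componentOf_mem_nontrivialComponents {x : α} (hx : IsEssential M x) :
    componentOf M x ∈ nontrivialComponents M := by
  refine mem_nontrivialComponents_iff.2 ⟨componentOf_mem hx.mem_ground, fun y hy => ?_⟩
  rcases hy.2.eq_or_isEssential with rfl | h
  exacts [hx, h.2]

lemma component_nonempty {S : Set α} (hS : S ∈ components M) : S.Nonempty := by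
  obtain ⟨a, ha, rfl⟩ := hS
  exact ⟨a, mem_componentOf ha⟩

/-- The sum of the base polytopes of a set of components. -/
lemma finsum_basePolytope_restrict [Finite α] {A : Set (Set α)} (hA : A ⊆ components M) :
    ∑ᶠ S ∈ A, basePolytope (M.restrict S) = scaledPolytope M ((⋃₀ A).indicator 1) := by
  rw [finsum_mem_eq_finite_toFinset_sum _ (toFinite A), Finset.sum_congr rfl fun S hS =>
    basePolytope_restrict (component_subset (hA ((toFinite A).mem_toFinset.1 hS)))
      (component_closed (hA ((toFinite A).mem_toFinset.1 hS))),
    scaledPolytope_sum _ fun S hS => isWeight_component (hA ((toFinite A).mem_toFinset.1 hS))]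
  congr 1
  ext z
  rw [Finset.sum_apply]
  by_cases hz : z ∈ ⋃₀ A
  · obtain ⟨S, hS, hzS⟩ := hz
    rw [Finset.sum_eq_single_of_mem S (by simpa using hS)]
    · rw [indicator_of_mem hzS, indicator_of_mem (mem_sUnion_of_mem hzS hS)]
    · intro T hT hTS
      refine indicator_of_notMem (fun hzT => hTS ?_) _
      exact component_eq_of_mem (hA (by simpa using hT)) (hA hS) hzT hzS
  · rw [indicator_of_notMem hz]
    refine Finset.sum_eq_zero fun T hT => indicator_of_notMem (fun hzT => hz ?_) _
    exact ⟨T, by simpa using hT, hzT⟩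

lemma sUnion_components : ⋃₀ components M = M.E := by
  ext z
  constructor
  · rintro ⟨S, hS, hz⟩
    exact component_subset hS hz
  · exact fun hz => ⟨_, componentOf_mem hz, mem_componentOf hz⟩

end Weights

/-! ### Faces of convex hulls. -/

section Faces

variable {V : Type*} [AddCommGroup V] [Module ℝ V]

lemma convex_face {P : Set V} (hP : Convex ℝ P) (c : Module.Dual ℝ V) : Convex ℝ (face P c) := by
  intro x hx y hy a b ha hb hab
  refine ⟨hP hx.1 hy.1 ha hb hab, fun z hz => ?_⟩
  have h1 := hx.2 z hz
  have h2 := hy.2 z hz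
  rw [map_add, map_smul, map_smul, smul_eq_mul, smul_eq_mul]
  have : c z = a * c z + b * c z := by rw [← add_mul, hab, one_mul]
  rw [this]
  gcongr

lemma le_of_mem_convexHull {s : Set V} {c : Module.Dual ℝ V} {m : ℝ} (h : ∀ y ∈ s, c y ≤ m)
    {x : V} (hx : x ∈ convexHull ℝ s) : c x ≤ m :=
  convexHull_min (t := {y | c y ≤ m}) h (convex_halfSpace_le c.isLinear m) hx

lemma face_convexHull (s : Set V) (c : Module.Dual ℝ V) :
    face (convexHull ℝ s) c = convexHull ℝ {x | x ∈ s ∧ ∀ y ∈ s, c y ≤ c x} := by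
  apply Subset.antisymm
  · rintro x ⟨hx, hmax⟩
    set F := {x | x ∈ s ∧ ∀ y ∈ s, c y ≤ c x} with hF
    -- The right-hand set is convex: a proper convex combination attains the maximum only if both of
    -- its points do.
    have key : convexHull ℝ s ⊆ {y | c y ≤ c x ∧ (c y = c x → y ∈ convexHull ℝ F)} := by
      refine convexHull_min (fun y hy => ?_) ?_
      · have hyx := hmax y (subset_convexHull ℝ s hy)
        refine ⟨hyx, fun h => subset_convexHull ℝ F ⟨hy, fun z hz => ?_⟩⟩
        rw [h]
        exact hmax z (subset_convexHull ℝ s hz)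
      · rintro y ⟨hy, hy'⟩ z ⟨hz, hz'⟩ a b ha hb hab
        have hsum : c (a • y + b • z) = a * c y + b * c z := by simp
        rcases ha.eq_or_lt with rfl | ha
        · obtain rfl : b = 1 := by linarith
          simpa using ⟨hz, hz'⟩
        rcases hb.eq_or_lt with rfl | hb
        · obtain rfl : a = 1 := by linarith
          simpa using ⟨hy, hy'⟩
        have hcx : c x = a * c x + b * c x := by rw [← add_mul, hab, one_mul]
        have h1 : a * c y ≤ a * c x := by gcongr
        have h2 : b * c z ≤ b * c x := by gcongr
        refine ⟨by rw [hsum]; linarith, fun h => ?_⟩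
        rw [hsum] at h
        have h3 : a * c y = a * c x := by linarith
        have h4 : b * c z = b * c x := by linarith
        exact (convex_convexHull ℝ F) (hy' (mul_left_cancel₀ ha.ne' h3))
          (hz' (mul_left_cancel₀ hb.ne' h4)) ha.le hb.le hab
    exact (key hx).2 rfl
  · refine convexHull_min ?_ (convex_face (convex_convexHull ℝ s) c)
    rintro x ⟨hx, hmax⟩
    exact ⟨subset_convexHull ℝ s hx, fun y hy => le_of_mem_convexHull hmax hy⟩

end Faces

/-! ### Vertices and exchange edges of the base polytope. -/

section BaseFaces

variable {α : Type*} {M : Matroid α}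

lemma indicator_one_injective : Function.Injective fun B : Set α => B.indicator (1 : α → ℝ) := by
  intro B B' h
  ext z
  have := congrFun h z
  by_cases h1 : z ∈ B <;> by_cases h2 : z ∈ B' <;> simp_all

lemma face_basePolytope (M : Matroid α) (c : Module.Dual ℝ (α → ℝ)) :
    face (basePolytope M) c = convexHull ℝ ((fun B : Set α => B.indicator (1 : α → ℝ)) ''
      {B | M.IsBase B ∧ ∀ B', M.IsBase B' → c (B'.indicator 1) ≤ c (B.indicator 1)}) := by
  rw [basePolytope, face_convexHull]
  congr 1
  ext x
  constructor
  · rintro ⟨⟨B, hB, rfl⟩, h⟩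
    exact ⟨B, ⟨hB, fun B' hB' => h _ ⟨B', hB', rfl⟩⟩, rfl⟩
  · rintro ⟨B, ⟨hB, h⟩, rfl⟩
    refine ⟨⟨B, hB, rfl⟩, ?_⟩
    rintro _ ⟨B', hB', rfl⟩
    exact h B' hB'

lemma mem_face_basePolytope {B : Set α} (hB : M.IsBase B) {c : Module.Dual ℝ (α → ℝ)}
    (h : ∀ B', M.IsBase B' → c (B'.indicator 1) ≤ c (B.indicator 1)) :
    B.indicator 1 ∈ face (basePolytope M) c := by
  rw [face_basePolytope]
  exact subset_convexHull ℝ _ ⟨B, ⟨hB, h⟩, rfl⟩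

lemma exists_isBase_mem_face [Finite α] (c : Module.Dual ℝ (α → ℝ)) :
    ∃ B, M.IsBase B ∧ B.indicator 1 ∈ face (basePolytope M) c := by
  obtain ⟨B, hB, h⟩ := exists_max_image {B | M.IsBase B} (fun B => c (B.indicator 1))
    (toFinite _) M.exists_isBase
  exact ⟨B, hB, mem_face_basePolytope hB h⟩

/-- A functional that, among the indicator vectors, is maximal exactly on those of the sets between
`I` and `J`. -/
lemma exists_dual_maximal_between [Finite α] {I J : Set α} (hIJ : I ⊆ J) :
    ∃ c : Module.Dual ℝ (α → ℝ), ∀ B, I ⊆ B → B ⊆ J → ∀ B' : Set α,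
      c (B'.indicator 1) ≤ c (B.indicator 1) ∧
      (c (B'.indicator 1) = c (B.indicator 1) → I ⊆ B' ∧ B' ⊆ J) := by
  classical
  have := Fintype.ofFinite α
  -- Weight `1` on `I`, `-1` outside `J` and `0` in between: each coordinate is maximized
  -- separately, so equality of sums forces equality everywhere.
  let w : α → ℝ := I.indicator 1 - Jᶜ.indicator 1
  let c : Module.Dual ℝ (α → ℝ) := ∑ z, w z • LinearMap.proj (φ := fun _ : α => ℝ) z
  have hc : ∀ v, c v = ∑ z, w z * v z := fun v => by simp [c]
  refine ⟨c, fun B hIB hBJ B' => ?_⟩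
  have hle : ∀ z ∈ Finset.univ, w z * B'.indicator 1 z ≤ w z * B.indicator 1 z := by
    intro z _
    by_cases hI : z ∈ I
    · by_cases h : z ∈ B' <;> simp [w, hI, hIJ hI, hIB hI, h]
    · by_cases hJ : z ∈ J
      · simp [w, hI, hJ]
      · have : z ∉ B := fun h => hJ (hBJ h)
        by_cases h : z ∈ B' <;> simp [w, hI, hJ, this, h]
  rw [hc, hc]
  refine ⟨Finset.sum_le_sum hle, fun h => ?_⟩
  rw [Finset.sum_eq_sum_iff_of_le hle] at h
  constructor
  · intro z hz
    by_contra h'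
    have := h z (Finset.mem_univ z)
    simp [w, hz, hIJ hz, hIB hz, h'] at this
  · intro z hz
    by_contra h'
    have := h z (Finset.mem_univ z)
    simp [w, hz, h', show z ∉ I from fun h => h' (hIJ h), show z ∉ B from fun h => h' (hBJ h)] at this

lemma exists_face_eq_singleton [Finite α] {B : Set α} (hB : M.IsBase B) :
    ∃ c, face (basePolytope M) c = {B.indicator 1} := by
  obtain ⟨c, hc⟩ := exists_dual_maximal_between (subset_refl B)
  refine ⟨c, ?_⟩
  rw [face_basePolytope, ← convexHull_singleton (𝕜 := ℝ),
    ← image_singleton (f := fun B : Set α => B.indicator (1 : α → ℝ))]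
  refine congrArg (convexHull ℝ) (congrArg (image _) ?_)
  ext B'
  constructor
  · rintro ⟨hB', h⟩
    have := (hc B subset_rfl subset_rfl B').2
      (le_antisymm (hc B subset_rfl subset_rfl B').1 (h B hB))
    exact subset_antisymm this.2 this.1
  · rintro rfl
    exact ⟨hB, fun B' _ => (hc _ subset_rfl subset_rfl B').1⟩

/-- A basis between `B \ {x}` and `insert y B` contains `B` if it contains `x`, and otherwise lies
in `insert y (B \ {x})`. Nested bases are equal, so just these two are maximal. -/
lemma exists_face_eq_segment [Finite α] {B : Set α} {x y : α} (hB : M.IsBase B) (hx : x ∈ B)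
    (hB' : M.IsBase (insert y (B \ {x}))) :
    ∃ c, face (basePolytope M) c =
      segment ℝ (B.indicator 1) ((insert y (B \ {x})).indicator 1) := by
  have hIJ : B \ {x} ⊆ insert y B := sdiff_subset.trans (subset_insert _ _)
  obtain ⟨c, hc⟩ := exists_dual_maximal_between hIJ
  have h1 := hc B sdiff_subset (subset_insert _ _)
  have h2 := hc (insert y (B \ {x})) (subset_insert _ _) (insert_subset_insert sdiff_subset)
  refine ⟨c, ?_⟩
  rw [face_basePolytope, ← convexHull_pair (𝕜 := ℝ),
    ← image_pair (fun B : Set α => B.indicator (1 : α → ℝ))]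
  refine congrArg (convexHull ℝ) (congrArg (image _) ?_)
  ext D
  constructor
  · rintro ⟨hD, h⟩
    obtain ⟨h3, h4⟩ := (h1 D).2 (le_antisymm (h1 D).1 (h B hB))
    by_cases hxD : x ∈ D
    · left
      refine (hB.eq_of_subset_isBase hD fun z hz => ?_).symm
      by_cases hzx : z = x
      exacts [hzx ▸ hxD, h3 ⟨hz, hzx⟩]
    · right
      refine hD.eq_of_subset_isBase hB' fun z hz => ?_
      rcases h4 hz with h | h
      exacts [Or.inl h, Or.inr ⟨h, fun hzx => hxD (hzx ▸ hz)⟩]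
  · rintro (rfl | rfl)
    exacts [⟨hB, fun B' _ => (h1 B').1⟩, ⟨hB', fun B' _ => (h2 B').1⟩]

end BaseFaces

/-! ### Deformations are weights; indecomposability. -/

section Deformations

variable {α : Type*} {M : Matroid α} {μ ν : α → ℝ}

/-- A map on the bases that preserves the directions of all exchanges is, up to translation, the
multiplication of the indicator vectors with a weight. -/
lemma exists_weight_of_exchange [Finite α] (ψ : Set α → α → ℝ)
    (h : ∀ B x y, M.IsBase B → x ∈ B → y ∉ B → M.IsBase (insert y (B \ {x})) →
      ∃ l : ℝ, 0 ≤ l ∧ ψ (insert y (B \ {x})) - ψ B =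
        l • ((insert y (B \ {x})).indicator 1 - B.indicator 1)) :
    ∃ μ, IsWeight M μ ∧ ∃ b, ∀ B, M.IsBase B → ψ B = μ * B.indicator 1 + b := by
  have inv : ∀ {z B B'}, M.IsBase B → M.IsBase B' → (z ∈ B ↔ z ∈ B') → ψ B z = ψ B' z := by
    intro z B B' hB hB' hz
    refine eq_of_exchange_invariant (M := M) (z := z) (fun B => ψ B z) ?_ hB hB' hz
    intro B x y hB hx hy hB' hzx hzy
    obtain ⟨l, -, hl⟩ := h B x y hB hx hy hB'
    have := congrFun hl z
    by_cases hzB : z ∈ B <;> simp [hzx, hzy, hzB] at this <;> linarith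
  -- At nonessential `z` the factor is not determined; the choice `0` makes `μ` vanish off the
  -- ground set.
  have key : ∀ z, ∃ m b : ℝ, 0 ≤ m ∧ (¬ IsEssential M z → m = 0) ∧
      ∀ B, M.IsBase B → ψ B z = m * B.indicator 1 z + b := by
    intro z
    by_cases hz : IsEssential M z
    · obtain ⟨⟨B₁, hB₁, hz₁⟩, ⟨B₂, hB₂, hz₂⟩⟩ := hz
      refine ⟨ψ B₁ z - ψ B₂ z, ψ B₂ z, ?_, fun h => absurd ⟨⟨B₁, hB₁, hz₁⟩, ⟨B₂, hB₂, hz₂⟩⟩ h,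
        fun B hB => ?_⟩
      · obtain ⟨y, ⟨hy, hy'⟩, hB'⟩ := hB₁.exchange hB₂ ⟨hz₁, hz₂⟩
        obtain ⟨l, hl0, hl⟩ := h B₁ z y hB₁ hz₁ hy' hB'
        have hzy : z ≠ y := fun h => hy' (h ▸ hz₁)
        have := congrFun hl z
        rw [Pi.sub_apply, inv hB' hB₂ (by simp [hzy, hz₂])] at this
        simp [hzy, hz₁] at this
        linarith
      · by_cases hzB : z ∈ B
        · simp [hzB, inv hB hB₁ (iff_of_true hzB hz₁)]
        · simp [hzB, inv hB hB₂ (iff_of_false hzB hz₂)]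
    · obtain ⟨B₀, hB₀⟩ := M.exists_isBase
      refine ⟨0, ψ B₀ z, le_rfl, fun _ => rfl, fun B hB => ?_⟩
      rw [zero_mul, zero_add]
      refine inv hB hB₀ ⟨fun h1 => ?_, fun h1 => ?_⟩
      · by_contra h2
        exact hz ⟨⟨B, hB, h1⟩, ⟨B₀, hB₀, h2⟩⟩
      · by_contra h2
        exact hz ⟨⟨B₀, hB₀, h1⟩, ⟨B, hB, h2⟩⟩
  choose μ b h0 hne hψ using key
  refine ⟨μ, ⟨h0, fun z hz => hne z fun h => hz h.mem_ground, ?_⟩, b, fun B hB =>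
    funext fun z => hψ z B hB⟩
  rintro x y (rfl | ⟨C, hC, hx, hy⟩)
  · rfl
  by_cases hxy : x = y
  · rw [hxy]
  obtain ⟨B, hB, hxB, hyB, hB'⟩ := exists_exchange_of_isCircuit hC hx hy hxy
  obtain ⟨l, -, hl⟩ := h B x y hB hxB hyB hB'
  have h1 := congrFun hl x
  have h2 := congrFun hl y
  simp [hψ _ _ hB, hψ _ _ hB', hxB, hyB, hxy] at h1 h2
  linarith

/-- Every deformation of a base polytope is obtained by rescaling the components. -/
theorem IsDeformation.exists_weight [Finite α] {Q : Set (α → ℝ)}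
    (hQ : IsDeformation Q (basePolytope M)) :
    ∃ μ, IsWeight M μ ∧ ∃ b, Q = scaledPolytope M μ + {b} := by
  obtain ⟨hQp, R, hR, l, hl, hP⟩ := hQ
  -- Each vertex splits as `l • q B + r B`; then `q B` maximizes on `Q` every functional that the
  -- vertex maximizes on the base polytope.
  have hdec : ∀ B, ∃ q r, M.IsBase B → q ∈ Q ∧ r ∈ R ∧ l • q + r = B.indicator (1 : α → ℝ) := by
    intro B
    by_cases hB : M.IsBase B
    · have := indicator_mem_basePolytope hB
      rw [hP] at this
      obtain ⟨_, ⟨q, hq, rfl⟩, r, hr, h⟩ := this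
      exact ⟨q, r, fun _ => ⟨hq, hr, h⟩⟩
    · exact ⟨0, 0, fun h => absurd h hB⟩
  choose q r hqr using hdec
  have hmem : ∀ B, M.IsBase B → ∀ q' ∈ Q, l • q' + r B ∈ basePolytope M := by
    intro B hB q' hq'
    rw [hP]
    exact add_mem_add (smul_mem_smul_set hq') (hqr B hB).2.1
  have hmax : ∀ B, M.IsBase B → ∀ c : Module.Dual ℝ (α → ℝ),
      B.indicator 1 ∈ face (basePolytope M) c → ∀ q' ∈ Q, c q' ≤ c (q B) := by
    intro B hB c hc q' hq'
    have := hc.2 _ (hmem B hB q' hq')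
    rw [← (hqr B hB).2.2, map_add, map_add, map_smul, map_smul, smul_eq_mul, smul_eq_mul] at this
    exact le_of_mul_le_mul_left (by linarith) hl
  obtain ⟨μ, hμ, b, hb⟩ := exists_weight_of_exchange (M := M) q (by
    intro B x y hB hx hy hB'
    obtain ⟨c, hc⟩ := exists_face_eq_segment hB hx hB'
    have h1 := hmax B hB c (hc ▸ left_mem_segment ℝ _ _)
    have h2 := hmax _ hB' c (hc ▸ right_mem_segment ℝ _ _)
    have h3 := le_antisymm (h1 _ (hqr _ hB').1) (h2 _ (hqr _ hB).1)
    -- Both `q`-points maximize `c` on `Q`, so replacing one by the other keeps the vertex `l • q B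
    -- + r B` on the edge. Its displacement is thus a nonnegative multiple of the edge direction.
    have h4 : l • q (insert y (B \ {x})) + r B ∈ face (basePolytope M) c := by
      refine ⟨hmem B hB _ (hqr _ hB').1, fun w hw => ?_⟩
      have h5 : B.indicator 1 ∈ face (basePolytope M) c := hc ▸ left_mem_segment ℝ _ _
      refine (h5.2 w hw).trans ?_
      rw [← (hqr B hB).2.2, map_add, map_add, map_smul, map_smul, h3]
    rw [hc, segment_eq_image'] at h4
    obtain ⟨t, ht, h⟩ := h4
    refine ⟨l⁻¹ * t, mul_nonneg (inv_nonneg.2 hl.le) ht.1, ?_⟩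
    rw [mul_smul, eq_inv_smul_iff₀ hl.ne', smul_sub]
    dsimp only at h
    rw [← eq_sub_iff_add_eq'] at h
    rw [h]
    conv_rhs => rw [← (hqr B hB).2.2]
    abel)
  refine ⟨μ, hμ, b, Subset.antisymm (fun x hx => ?_) ?_⟩
  · by_contra hxK
    have hK : IsPolytope (scaledPolytope M μ + {b}) :=
      (isPolytope_scaledPolytope M μ).add (isPolytope_singleton b)
    obtain ⟨s, hs, -, hKs⟩ := hK
    rw [hKs] at hxK
    -- A point of `Q` outside would be separated by some `f`, but `f` attains its maximum over `Q`
    -- at some `q B`, which lies in the rescaled polytope.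
    obtain ⟨f, u, hf, hu⟩ := geometric_hahn_banach_closed_point (convex_convexHull ℝ s)
      (hs.isClosed_convexHull ℝ) hxK
    obtain ⟨B, hB, hBf⟩ := exists_isBase_mem_face (M := M) f.toLinearMap
    have h1 := hmax B hB _ hBf x hx
    have h2 : f (q B) < u := by
      apply hf
      rw [← hKs, hb B hB]
      exact add_mem_add ⟨_, indicator_mem_basePolytope hB, rfl⟩ rfl
    exact absurd (hu.trans_le h1) (not_lt.2 h2.le)
  · rw [add_singleton]
    rintro _ ⟨_, ⟨v, hv, rfl⟩, rfl⟩
    have hconv : Convex ℝ Q := by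
      obtain ⟨s, -, -, rfl⟩ := hQp
      exact convex_convexHull ℝ s
    refine basePolytope_subset_of_convex (M := M)
      (C := LinearMap.mulLeft ℝ μ ⁻¹' ((fun v => v + b) ⁻¹' Q))
      ((hconv.translate_preimage_left b).linear_preimage _) (fun B hB => ?_) hv
    have := (hqr B hB).1
    rwa [hb B hB] at this

lemma isDeformation_add [Finite α] (hμ : IsWeight M μ) (hν : IsWeight M ν) (s t : α → ℝ) :
    IsDeformation (scaledPolytope M μ + {s}) (scaledPolytope M (μ + ν) + {t}) := by
  refine ⟨(isPolytope_scaledPolytope M μ).add (isPolytope_singleton s),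
    scaledPolytope M ν + {t - s}, (isPolytope_scaledPolytope M ν).add (isPolytope_singleton _),
    1, one_pos, ?_⟩
  rw [one_smul, add_add_add_comm, scaledPolytope_add hμ hν, singleton_add_singleton,
    add_sub_cancel]

lemma exists_scaledPolytope_eq_smul_add {l : ℝ} (h : ∀ z, IsEssential M z → μ z = l * ν z)
    (s t : α → ℝ) :
    ∃ u, scaledPolytope M μ + {s} = l • (scaledPolytope M ν + {t}) + {u} := by
  obtain ⟨u, hu⟩ := exists_scaledPolytope_eq_add (M := M) (μ := μ) (ν := l • ν) (by simpa using h)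
  refine ⟨u + s - l • t, ?_⟩
  rw [smul_add, smul_set_singleton, smul_scaledPolytope, hu, add_assoc, add_assoc,
    singleton_add_singleton, singleton_add_singleton, add_sub_cancel]

/-- Otherwise cutting `μ` down to the component of `x` yields a deformation whose weight would be `l
• μ` on essential elements: `l = 1` at `x`, but `l = 0` at `y`. -/
lemma IsIndecomposable.inCommonCircuit [Finite α] {t : α → ℝ} (hμ : IsWeight M μ)
    (h : IsIndecomposable (scaledPolytope M μ + {t})) {x y : α} (hx : IsEssential M x)
    (hy : IsEssential M y) (hμx : 0 < μ x) (hμy : 0 < μ y) : InCommonCircuit M x y := by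
  by_contra hxy
  have hS := componentOf_mem hx.mem_ground
  set S := componentOf M x
  have hyS : y ∉ S := fun h => hxy h.2
  have h1 : IsWeight M (μ * S.indicator 1) := hμ.mul (isWeight_component hS)
  have h2 : IsWeight M (μ * (M.E \ S).indicator 1) :=
    hμ.mul (isWeight_indicator sdiff_subset fun a ha b hab =>
      ⟨hab.mem_ground ha.1, fun hb => ha.2 (component_closed hS b hb a hab.symm)⟩)
  have h3 : μ * S.indicator 1 + μ * (M.E \ S).indicator 1 = μ := by
    ext z
    by_cases hzE : z ∈ M.E
    · by_cases hzS : z ∈ S <;> simp [hzE, hzS]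
    · simp [hμ.eq_zero z hzE]
  have hd := isDeformation_add h1 h2 0 t
  rw [h3] at hd
  obtain ⟨l, hl, t', ht'⟩ := h.2 _ hd
  rw [smul_add, smul_set_singleton, smul_scaledPolytope, add_assoc, singleton_add_singleton] at ht'
  have hlμ := hμ.smul hl
  have hwx := weight_eq_of_scaledPolytope_eq h1.nonneg hlμ.nonneg ht' hx
  have hwy := weight_eq_of_scaledPolytope_eq h1.nonneg hlμ.nonneg ht' hy
  have hxS : x ∈ S := mem_componentOf hx.mem_ground
  simp [hxS, hyS] at hwx hwy
  rcases hwy with rfl | hwy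
  · simp at hwx
    exact hμx.ne' hwx
  · exact hμy.ne' hwy

lemma basePolytope_eq_scaledPolytope_add :
    basePolytope M = scaledPolytope M (M.E.indicator 1) + {0} := by
  rw [scaledPolytope_indicator_ground]
  exact (add_zero _).symm

theorem isIndecomposable_basePolytope_iff [Finite α] :
    IsIndecomposable (basePolytope M) ↔ IsConnected (strip M) := by
  rw [strip_isConnected_iff]
  constructor
  · intro h x y hx hy
    rw [basePolytope_eq_scaledPolytope_add] at h
    exact h.inCommonCircuit isWeight_indicator_ground hx hy (by simp [hx.mem_ground])
      (by simp [hy.mem_ground])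
  · intro h
    refine ⟨isPolytope_basePolytope M, fun Q hQ => ?_⟩
    obtain ⟨μ, hμ, b, rfl⟩ := hQ.exists_weight
    obtain ⟨l, hl, hlμ⟩ : ∃ l : ℝ, 0 ≤ l ∧ ∀ z, IsEssential M z → μ z = l := by
      by_cases hx : ∃ x, IsEssential M x
      · obtain ⟨x, hx⟩ := hx
        exact ⟨μ x, hμ.nonneg x, fun z hz => hμ.congr z x (h z x hz hx)⟩
      · exact ⟨0, le_rfl, fun z hz => absurd ⟨z, hz⟩ hx⟩
    refine ⟨l, hl, ?_⟩
    obtain ⟨u, hu⟩ := exists_scaledPolytope_eq_smul_add (M := M) (μ := μ) (ν := M.E.indicator 1)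
      (l := l) (fun z hz => by simp [hlμ z hz, hz.mem_ground]) b 0
    rw [← basePolytope_eq_scaledPolytope_add] at hu
    exact ⟨u, hu⟩

theorem isIndecomposable_basePolytope [Finite α] (h : IsConnected M) :
    IsIndecomposable (basePolytope M) := by
  rw [isIndecomposable_basePolytope_iff, strip_isConnected_iff]
  exact fun x y hx hy => h x hx.mem_ground y hy.mem_ground

lemma isConnected_restrict [Finite α] {S : Set α} (hS : S ∈ components M) :
    IsConnected (M.restrict S) := by
  intro x hx y hy
  rcases inCommonCircuit_of_mem_component hS hx hy with h | ⟨C, hC, hxC, hyC⟩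
  · exact Or.inl h
  · exact Or.inr ⟨C, hC.isCircuit_restrict_of_subset fun z hz =>
      component_closed hS x hx z (Or.inr ⟨C, hC, hxC, hz⟩), hxC, hyC⟩

lemma nontrivial_basePolytope_restrict_iff [Finite α] {S : Set α} (hS : S ∈ components M) :
    (basePolytope (M.restrict S)).Nontrivial ↔ S ∈ nontrivialComponents M := by
  rw [basePolytope_restrict (component_subset hS) (component_closed hS),
    mem_nontrivialComponents_iff, and_iff_right hS]
  constructor
  · rintro ⟨_, ⟨v, hv, rfl⟩, _, ⟨w, hw, rfl⟩, hne⟩ x hx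
    by_contra hxe
    refine hne ?_
    ext z
    by_cases hz : z ∈ S
    · rcases (inCommonCircuit_of_mem_component hS hx hz).eq_or_isEssential with rfl | h
      · simp [apply_eq_of_not_isEssential hv hw hxe]
      · exact absurd h.1 hxe
    · simp [hz]
  · intro h
    obtain ⟨x, hx⟩ := component_nonempty hS
    obtain ⟨⟨v, hv, w, hw, hvw⟩, -⟩ :=
      exists_width_eq (M := M) (isWeight_component hS).nonneg (h x hx) 0
    rw [singleton_zero, add_zero] at hv hw
    refine ⟨v, hv, w, hw, ?_⟩
    rintro rfl
    simp [hx] at hvw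

theorem basePolytope_eq_finsum [Finite α] :
    basePolytope M = ∑ᶠ S ∈ components M, basePolytope (M.restrict S) := by
  rw [finsum_basePolytope_restrict subset_rfl, sUnion_components, scaledPolytope_indicator_ground]

end Deformations

/-! ### Uniqueness of the decomposition. -/

section Uniqueness

variable {α : Type*} {M : Matroid α} {μ ν : α → ℝ}

/-- Each summand has a weight, and the weights add up to `1` on essential elements.
Indecomposability confines each to one component there, and nonproportionality makes these
components distinct. So each weight equals `1` on its own component, and all nontrivial components
occur. -/
theorem exists_equiv_nontrivialComponents [Finite α] (n : ℕ) (R : Fin n → Set (α → ℝ))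
    (hR : ∀ i, IsIndecomposable (R i) ∧ (R i).Nontrivial)
    (hne : ∀ i j, i ≠ j → ¬ ∃ l : ℝ, 0 < l ∧ ∃ t : α → ℝ, R i = l • R j + {t})
    (hP : basePolytope M = ∑ i, R i) :
    ∃ e : Fin n ≃ nontrivialComponents M,
      ∀ i, ∃ t : α → ℝ, R i = basePolytope (M.restrict (e i)) + {t} := by
  classical
  have hdef : ∀ i, IsDeformation (R i) (basePolytope M) := fun i =>
    ⟨(hR i).1.1, ∑ j ∈ Finset.univ.erase i, R j, IsPolytope.sum _ fun j _ => (hR j).1.1, 1, one_pos,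
      by rw [hP, one_smul, Finset.add_sum_erase _ _ (Finset.mem_univ i)]⟩
  choose μ hμ b hb using fun i => (hdef i).exists_weight
  have hsum : ∀ z, IsEssential M z → ∑ i, μ i z = 1 := by
    intro z hz
    have h1 : scaledPolytope M (∑ i, μ i) + {∑ i, b i} =
        scaledPolytope M (M.E.indicator 1) + {0} := by
      have h2 : ∑ i, ({b i} : Set (α → ℝ)) = {∑ i, b i} :=
        (map_sum (Set.singletonAddMonoidHom (α := α → ℝ)) b Finset.univ).symm
      rw [← basePolytope_eq_scaledPolytope_add, hP, ← h2,
        ← scaledPolytope_sum _ fun i _ => hμ i, ← Finset.sum_add_distrib]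
      exact Finset.sum_congr rfl fun i _ => (hb i).symm
    have := weight_eq_of_scaledPolytope_eq (IsWeight.sum _ fun i _ => hμ i).nonneg
      isWeight_indicator_ground.nonneg h1 hz
    simpa [hz.mem_ground] using this
  have hpos : ∀ i, ∃ z, IsEssential M z ∧ 0 < μ i z := by
    intro i
    by_contra! h
    obtain ⟨t, ht⟩ := exists_scaledPolytope_eq_add (M := M) (μ := μ i) (ν := 0)
      fun z hz => le_antisymm (h z hz) ((hμ i).nonneg z)
    have := (hR i).2
    rw [hb i, ht, scaledPolytope_zero, zero_add, singleton_add_singleton] at this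
    exact not_nontrivial_singleton this
  choose z hz hzpos using hpos
  have hclass : ∀ i x, IsEssential M x → 0 < μ i x → InCommonCircuit M (z i) x := by
    intro i x hx hpx
    have := (hR i).1
    rw [hb i] at this
    exact this.inCommonCircuit (hμ i) (hz i) hx (hzpos i) hpx
  have hval : ∀ i x, IsEssential M x →
      μ i x = μ i (z i) * (componentOf M (z i)).indicator 1 x := by
    intro i x hx
    by_cases h : InCommonCircuit M (z i) x
    · simp [componentOf, hx.mem_ground, h, (hμ i).congr _ _ h]
    · have : μ i x = 0 := by
        by_contra h0
        exact h (hclass i x hx (lt_of_le_of_ne ((hμ i).nonneg x) (Ne.symm h0)))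
      simp [componentOf, h, this]
  have hinj : ∀ i j, componentOf M (z i) = componentOf M (z j) → i = j := by
    intro i j hij
    by_contra hne'
    refine hne i j hne' ⟨μ i (z i) / μ j (z j), div_pos (hzpos i) (hzpos j), ?_⟩
    rw [hb i, hb j]
    refine exists_scaledPolytope_eq_smul_add (fun x hx => ?_) _ _
    rw [hval i x hx, hval j x hx, hij, ← mul_assoc, div_mul_cancel₀ _ (hzpos j).ne']
  have hone : ∀ i, μ i (z i) = 1 := by
    intro i
    rw [← hsum (z i) (hz i), Finset.sum_eq_single_of_mem i (Finset.mem_univ i)]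
    intro j _ hji
    rw [hval j _ (hz i), indicator_of_notMem, mul_zero]
    intro h
    exact hji (hinj j i (component_eq_of_mem (componentOf_mem (hz j).mem_ground)
      (componentOf_mem (hz i).mem_ground) h (mem_componentOf (hz i).mem_ground)))
  let f : Fin n → nontrivialComponents M := fun i =>
    ⟨componentOf M (z i), componentOf_mem_nontrivialComponents (hz i)⟩
  have hf : Function.Bijective f := by
    refine ⟨fun i j hij => hinj i j (congrArg Subtype.val hij), ?_⟩
    rintro ⟨S, hS⟩
    obtain ⟨hSc, hSe⟩ := mem_nontrivialComponents_iff.1 hS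
    obtain ⟨x, hx⟩ := component_nonempty hSc
    obtain ⟨i, hi⟩ : ∃ i, μ i x ≠ 0 := by
      by_contra! h
      simpa [h] using hsum x (hSe x hx)
    refine ⟨i, Subtype.ext ?_⟩
    refine component_eq_of_mem (componentOf_mem (hz i).mem_ground) hSc (x := x) ?_ hx
    exact ⟨(hSe x hx).mem_ground, hclass i x (hSe x hx)
      (lt_of_le_of_ne ((hμ i).nonneg x) (Ne.symm hi))⟩
  refine ⟨Equiv.ofBijective f hf, fun i => ?_⟩
  have hc := componentOf_mem (hz i).mem_ground
  obtain ⟨u, hu⟩ := exists_scaledPolytope_eq_smul_add (M := M) (μ := μ i)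
    (ν := (componentOf M (z i)).indicator 1) (l := 1)
    (fun x hx => by rw [hval i x hx, hone i]) (b i) 0
  refine ⟨u, ?_⟩
  rw [hb i, hu, one_smul, singleton_zero, add_zero]
  change _ = basePolytope (M.restrict (componentOf M (z i))) + {u}
  rw [basePolytope_restrict (component_subset hc) (component_closed hc)]

end Uniqueness

/-! ### Normal equivalence depends only on the support of the weight. -/

section NormalFan

variable {α : Type*} {M : Matroid α} {μ ν : α → ℝ}

lemma face_scaledPolytope_add (c : Module.Dual ℝ (α → ℝ)) (t : α → ℝ) :
    face (scaledPolytope M μ + {t}) c =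
      (fun v => μ * v + t) '' face (basePolytope M) (c ∘ₗ LinearMap.mulLeft ℝ μ) := by
  rw [add_singleton, scaledPolytope, image_image]
  ext x
  constructor
  · rintro ⟨⟨v, hv, rfl⟩, h⟩
    refine ⟨v, ⟨hv, fun w hw => ?_⟩, rfl⟩
    have := h _ ⟨w, hw, rfl⟩
    rw [map_add, map_add] at this
    exact le_of_add_le_add_right this
  · rintro ⟨v, ⟨hv, h⟩, rfl⟩
    refine ⟨⟨v, hv, rfl⟩, ?_⟩
    rintro _ ⟨w, hw, rfl⟩
    dsimp only
    rw [map_add, map_add]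
    exact add_le_add_left (h w hw) _

/-- For small `ε > 0`, `μ - ε • ν` is again a weight. Replacing `v` by `w` only in the `ε • ν` part
stays in `scaledPolytope M μ`, so maximality for `μ` passes to `ν`. -/
lemma face_comp_mulLeft_subset [Finite α] (hμ : IsWeight M μ) (hν : IsWeight M ν)
    (h : ∀ z, μ z = 0 → ν z = 0) (c : Module.Dual ℝ (α → ℝ)) :
    face (basePolytope M) (c ∘ₗ LinearMap.mulLeft ℝ μ) ⊆
      face (basePolytope M) (c ∘ₗ LinearMap.mulLeft ℝ ν) := by
  obtain ⟨ε, hε, hεpos⟩ : ∃ ε : ℝ, (∀ z, ε * ν z ≤ μ z) ∧ 0 < ε := by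
    have h1 : ∀ z, ∀ᶠ ε in nhdsWithin (0 : ℝ) (Ioi 0), ε * ν z ≤ μ z := by
      intro z
      rcases (hμ.nonneg z).eq_or_lt with h0 | h0
      · simp [h z h0.symm, ← h0]
      · have : Filter.Tendsto (fun ε : ℝ => ε * ν z) (nhds 0) (nhds (0 * ν z)) :=
          Filter.tendsto_id.mul_const (ν z)
        rw [zero_mul] at this
        exact ((this.eventually_lt_const h0).filter_mono nhdsWithin_le_nhds).mono
          fun _ h => h.le
    exact ((Filter.eventually_all.2 h1).and self_mem_nhdsWithin).exists
  have hεν := hν.smul hεpos.le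
  have hsub : IsWeight M (μ - ε • ν) :=
    ⟨fun z => sub_nonneg.2 (hε z), fun z hz => by simp [hμ.eq_zero z hz, hν.eq_zero z hz],
      fun x y hxy => by simp [hμ.congr x y hxy, hν.congr x y hxy]⟩
  rintro v ⟨hv, hmax⟩
  refine ⟨hv, fun w hw => ?_⟩
  have hmem : (ε • ν) * w + (μ - ε • ν) * v ∈ scaledPolytope M μ := by
    have := scaledPolytope_add hεν hsub
    rw [add_sub_cancel] at this
    rw [← this]
    exact add_mem_add ⟨w, hw, rfl⟩ ⟨v, hv, rfl⟩
  obtain ⟨u, hu, hu'⟩ := hmem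
  have h1 := hmax u hu
  simp only [LinearMap.comp_apply] at h1 ⊢
  rw [hu', map_add, sub_mul, map_sub, smul_mul_assoc, smul_mul_assoc, map_smul, map_smul,
    smul_eq_mul, smul_eq_mul] at h1
  simp only [LinearMap.mulLeft_apply] at h1 ⊢
  exact le_of_mul_le_mul_left (by linarith) hεpos

lemma image_mul_add_subset_of_subset (h : ∀ z, μ z = 0 → ν z = 0) (s t : α → ℝ)
    {F G : Set (α → ℝ)} (hFG : (fun v => μ * v + s) '' F ⊆ (fun v => μ * v + s) '' G) :
    (fun v => ν * v + t) '' F ⊆ (fun v => ν * v + t) '' G := by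
  -- Where `μ` vanishes so does `ν`, and the convention `0 / 0 = 0` gives the right value.
  have key : ∀ v, ν * v + t = (fun u => ν / μ * (u - s) + t) (μ * v + s) := by
    intro v
    ext z
    by_cases hz : μ z = 0
    · simp [hz, h z hz]
    · simp [← mul_assoc, div_mul_cancel₀ _ hz]
  have hcomp : (fun v => ν * v + t) = (fun u => ν / μ * (u - s) + t) ∘ (fun v => μ * v + s) :=
    funext key
  rw [hcomp, image_comp, image_comp]
  exact image_mono hFG

lemma normallyEquivalent_scaledPolytope [Finite α] (hμ : IsWeight M μ) (hν : IsWeight M ν)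
    (h : ∀ z, μ z = 0 ↔ ν z = 0) (s t : α → ℝ) :
    NormallyEquivalent (scaledPolytope M μ + {s}) (scaledPolytope M ν + {t}) := by
  have hface : ∀ c : Module.Dual ℝ (α → ℝ),
      face (basePolytope M) (c ∘ₗ LinearMap.mulLeft ℝ μ) =
        face (basePolytope M) (c ∘ₗ LinearMap.mulLeft ℝ ν) := fun c =>
    Subset.antisymm (face_comp_mulLeft_subset hμ hν (fun z => (h z).1) c)
      (face_comp_mulLeft_subset hν hμ (fun z => (h z).2) c)
  have hiff : ∀ c d : Module.Dual ℝ (α → ℝ),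
      face (scaledPolytope M μ + {s}) c ⊆ face (scaledPolytope M μ + {s}) d ↔
        face (scaledPolytope M ν + {t}) c ⊆ face (scaledPolytope M ν + {t}) d := by
    intro c d
    simp only [face_scaledPolytope_add, hface]
    exact ⟨image_mul_add_subset_of_subset (fun z => (h z).1) s t,
      image_mul_add_subset_of_subset (fun z => (h z).2) t s⟩
  simp only [NormallyEquivalent, normalFan, hiff]

theorem IsDeformation.exists_normallyEquivalent [Finite α] {Q : Set (α → ℝ)}
    (hQ : IsDeformation Q (basePolytope M)) :
    ∃ A : Set (Set α), A ⊆ components M ∧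
      NormallyEquivalent Q (∑ᶠ S ∈ A, basePolytope (M.restrict S)) := by
  obtain ⟨μ, hμ, b, rfl⟩ := hQ.exists_weight
  -- The components supporting `μ`: the indicator of their union has the same zeros as `μ`.
  let A : Set (Set α) := {S | S ∈ components M ∧ ∀ x ∈ S, μ x ≠ 0}
  have hA : A ⊆ components M := fun S hS => hS.1
  refine ⟨A, hA, ?_⟩
  rw [finsum_basePolytope_restrict hA, ← add_zero (scaledPolytope M ((⋃₀ A).indicator 1)),
    ← singleton_zero]
  refine normallyEquivalent_scaledPolytope hμ (isWeight_indicator ?_ ?_) (fun z => ?_) _ _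
  · exact sUnion_subset fun S hS => component_subset hS.1
  · rintro x ⟨S, hS, hx⟩ y hxy
    exact ⟨S, hS, component_closed hS.1 x hx y hxy⟩
  · have : z ∈ ⋃₀ A ↔ μ z ≠ 0 := by
      refine ⟨fun ⟨S, hS, hz⟩ => hS.2 z hz, fun hz => ?_⟩
      have hzE : z ∈ M.E := by
        by_contra h
        exact hz (hμ.eq_zero z h)
      refine ⟨_, ⟨componentOf_mem hzE, fun x hx => ?_⟩, mem_componentOf hzE⟩
      rwa [← hμ.congr z x hx.2]
    by_cases hz : z ∈ ⋃₀ A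
    · simp only [indicator_of_mem hz, this.1 hz, Pi.one_apply, one_ne_zero]
    · simp only [indicator_of_notMem hz, not_not.1 (mt this.2 hz)]

end NormalFan

/-! ### Edges of the base polytope and the deformation cone. -/

section DeformationCone

variable {α : Type*} {M : Matroid α} {μ ν : α → ℝ}

lemma exists_isBase_of_mem_vertexSet [Finite α] {v : α → ℝ} (hv : v ∈ vertexSet (basePolytope M)) :
    ∃ B, M.IsBase B ∧ v = B.indicator 1 := by
  obtain ⟨c, hc⟩ := hv
  obtain ⟨B, hB, h⟩ := exists_isBase_mem_face (M := M) c
  rw [hc] at h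
  exact ⟨B, hB, (mem_singleton_iff.1 h).symm⟩

/-- The vertex of the base polytope given by a basis. -/
noncomputable def baseVertex [Finite α] {B : Set α} (hB : M.IsBase B) : vertexSet (basePolytope M) :=
  ⟨B.indicator 1, exists_face_eq_singleton hB⟩

lemma adj_of_exchange [Finite α] {B : Set α} {x y : α} (hB : M.IsBase B) (hx : x ∈ B)
    (hy : y ∉ B) (hB' : M.IsBase (insert y (B \ {x}))) :
    (polytopeGraph (basePolytope M)).Adj (baseVertex hB) (baseVertex hB') := by
  refine ⟨fun h => ?_, exists_face_eq_segment hB hx hB'⟩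
  have : B = insert y (B \ {x}) := indicator_one_injective (congrArg Subtype.val h)
  exact hy (this ▸ mem_insert _ _)

/-- Swapping `x` for any `y ∈ B' \ B` does not decrease `c`, so the new basis lies on the edge. Its
coordinate `x` is `0`, which on the segment happens only at the end `B'`. -/
lemma exchange_of_face_eq_segment {B B' : Set α} {x : α} (hB : M.IsBase B) (hB' : M.IsBase B')
    {c : Module.Dual ℝ (α → ℝ)}
    (hc : face (basePolytope M) c = segment ℝ (B.indicator 1) (B'.indicator 1)) (hx : x ∈ B)
    (hx' : x ∉ B')
    (hmin : ∀ y ∈ B' \ B, c (({x} : Set α).indicator 1) ≤ c (({y} : Set α).indicator 1)) :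
    ∃ y, y ∉ B ∧ B' = insert y (B \ {x}) := by
  obtain ⟨y, ⟨hy', hy⟩, hD⟩ := hB.exchange hB' ⟨hx, hx'⟩
  have hxy : x ≠ y := fun h => hy (h ▸ hx)
  have hDe : (insert y (B \ {x})).indicator (1 : α → ℝ) =
      B.indicator 1 - ({x} : Set α).indicator 1 + ({y} : Set α).indicator 1 := by
    ext z
    by_cases hzx : z = x
    · subst hzx
      simp [hx, hxy]
    · by_cases hzy : z = y
      · subst hzy
        simp [hzx, hy]
      · by_cases hzB : z ∈ B <;> simp [hzx, hzy, hzB]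
  have hBf : B.indicator 1 ∈ face (basePolytope M) c := hc ▸ left_mem_segment ℝ _ _
  have hDf : (insert y (B \ {x})).indicator 1 ∈ face (basePolytope M) c := by
    refine ⟨indicator_mem_basePolytope hD, fun w hw => (hBf.2 w hw).trans ?_⟩
    rw [hDe, map_add, map_sub]
    linarith [hmin y ⟨hy', hy⟩]
  rw [hc, segment_eq_image'] at hDf
  obtain ⟨t, -, ht⟩ := hDf
  have h1 := congrFun ht x
  simp [hx, hx', hxy] at h1
  have ht1 : t = 1 := by linarith
  simp only [ht1, one_smul, add_sub_cancel] at ht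
  exact ⟨y, hy, indicator_one_injective ht⟩

lemma exists_exchange_of_adj [Finite α] {u v : vertexSet (basePolytope M)}
    (h : (polytopeGraph (basePolytope M)).Adj u v) :
    ∃ B x y, M.IsBase B ∧ x ∈ B ∧ y ∉ B ∧ M.IsBase (insert y (B \ {x})) ∧
      ((u : α → ℝ) = B.indicator 1 ∧ (v : α → ℝ) = (insert y (B \ {x})).indicator 1 ∨
        (v : α → ℝ) = B.indicator 1 ∧ (u : α → ℝ) = (insert y (B \ {x})).indicator 1) := by
  obtain ⟨hne, c, hc⟩ := h
  obtain ⟨B, hB, hu⟩ := exists_isBase_of_mem_vertexSet u.2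
  obtain ⟨B', hB', hv⟩ := exists_isBase_of_mem_vertexSet v.2
  have hBB : (B \ B' ∪ B' \ B).Nonempty := by
    rw [nonempty_iff_ne_empty]
    intro h
    rw [union_empty_iff, sdiff_eq_empty, sdiff_eq_empty] at h
    exact hne (Subtype.ext (by rw [hu, hv, subset_antisymm h.1 h.2]))
  -- Minimizing over the whole symmetric difference provides the required inequality whichever basis
  -- contains `x`.
  obtain ⟨x, hx, hmin⟩ := exists_min_image _ (fun z => c (({z} : Set α).indicator 1))
    (toFinite _) hBB
  rw [hu, hv] at hc
  rcases hx with ⟨hx, hx'⟩ | ⟨hx, hx'⟩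
  · obtain ⟨y, hy, rfl⟩ := exchange_of_face_eq_segment hB hB' hc hx hx'
      fun y hy => hmin y (Or.inr hy)
    exact ⟨B, x, y, hB, hx, hy, hB', Or.inl ⟨hu, hv⟩⟩
  · rw [segment_symm] at hc
    obtain ⟨y, hy, rfl⟩ := exchange_of_face_eq_segment hB' hB hc hx hx'
      fun y hy => hmin y (Or.inl hy)
    exact ⟨B', x, y, hB', hx, hy, hB, Or.inr ⟨hv, hu⟩⟩

/-- All coordinates that change along an edge lie in one nontrivial component. -/
lemma exists_component_of_edge [Finite α] (e : (polytopeGraph (basePolytope M)).edgeSet) :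
    ∃ S : nontrivialComponents M, ∀ u v : vertexSet (basePolytope M), (e : Sym2 _) = s(u, v) →
      ∀ z, (u : α → ℝ) z ≠ (v : α → ℝ) z → z ∈ (S : Set α) := by
  obtain ⟨⟨u, v⟩, he⟩ := e
  obtain ⟨B, x, y, hB, hx, hy, hB', h⟩ := exists_exchange_of_adj he
  have hxy : x ≠ y := fun h => hy (h ▸ hx)
  have hxe : IsEssential M x := ⟨⟨B, hB, hx⟩, ⟨_, hB', by simp [hxy]⟩⟩
  have hd : ∀ z, B.indicator (1 : α → ℝ) z ≠ (insert y (B \ {x})).indicator 1 z →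
      z ∈ componentOf M x := by
    intro z hz
    by_cases hzx : z = x
    · rw [hzx]
      exact mem_componentOf hxe.mem_ground
    by_cases hzy : z = y
    · rw [hzy]
      exact ⟨hB'.subset_ground (mem_insert _ _), inCommonCircuit_of_exchange hB hy hB'⟩
    · exact absurd (by by_cases hzB : z ∈ B <;> simp [hzx, hzy, hzB]) hz
  refine ⟨⟨_, componentOf_mem_nontrivialComponents hxe⟩, fun u' v' he' z hz => hd z ?_⟩
  rcases Sym2.eq_iff.1 he' with ⟨rfl, rfl⟩ | ⟨rfl, rfl⟩ <;>
    rcases h with ⟨h1, h2⟩ | ⟨h1, h2⟩ <;> rw [h1, h2] at hz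
  exacts [hz, hz.symm, hz.symm, hz]

/-- The component in which an edge of the base polytope moves. -/
noncomputable def edgeComponent [Finite α] (e : (polytopeGraph (basePolytope M)).edgeSet) :
    nontrivialComponents M :=
  (exists_component_of_edge e).choose

lemma mem_edgeComponent [Finite α] {u v : vertexSet (basePolytope M)}
    (h : (polytopeGraph (basePolytope M)).Adj u v) {z : α}
    (hz : (u : α → ℝ) z ≠ (v : α → ℝ) z) :
    z ∈ (edgeComponent ⟨s(u, v), (polytopeGraph _).mem_edgeSet.2 h⟩ : Set α) :=
  (exists_component_of_edge ⟨s(u, v), _⟩).choose_spec u v rfl z hz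

lemma edgeComponent_surjective [Finite α] :
    Function.Surjective (edgeComponent (M := M)) := by
  rintro ⟨S, hS⟩
  obtain ⟨hSc, hSe⟩ := mem_nontrivialComponents_iff.1 hS
  obtain ⟨x, hx⟩ := component_nonempty hSc
  obtain ⟨⟨B₁, hB₁, hx₁⟩, ⟨B₂, hB₂, hx₂⟩⟩ := hSe x hx
  obtain ⟨y, ⟨-, hy⟩, hB⟩ := hB₁.exchange hB₂ ⟨hx₁, hx₂⟩
  have hxy : x ≠ y := fun h => hy (h ▸ hx₁)
  refine ⟨⟨_, (polytopeGraph _).mem_edgeSet.2 (adj_of_exchange hB₁ hx₁ hy hB)⟩, Subtype.ext ?_⟩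
  refine component_eq_of_mem (edgeComponent _).2.1 hSc
    (mem_edgeComponent (adj_of_exchange hB₁ hx₁ hy hB) ?_) hx
  simp [baseVertex, hx₁, hxy]

/-- The elements of the deformation cone are the restrictions of the weights to the edges. -/
lemma mem_deformationCone_iff [Finite α]
    {l : (polytopeGraph (basePolytope M)).edgeSet → ℝ} :
    l ∈ deformationCone (basePolytope M) ↔
      ∃ μ, IsWeight M μ ∧ ∀ e, ∀ z ∈ (edgeComponent e : Set α), l e = μ z := by
  classical
  constructor
  · rintro ⟨ψ, hψ⟩
    obtain ⟨μ, hμ, b, hb⟩ := exists_weight_of_exchange (M := M)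
      (fun B => if hB : M.IsBase B then ψ (baseVertex hB) else 0) (by
        intro B x y hB hx hy hB'
        obtain ⟨h1, h2, -⟩ := hψ _ _ (adj_of_exchange hB hx hy hB')
        refine ⟨_, h1, ?_⟩
        rw [dif_pos hB, dif_pos hB']
        exact h2)
    have hψb : ∀ v : vertexSet (basePolytope M), ψ v = μ * (v : α → ℝ) + b := by
      rintro ⟨v, hv⟩
      obtain ⟨B, hB, rfl⟩ := exists_isBase_of_mem_vertexSet hv
      have := hb B hB
      rw [dif_pos hB] at this
      exact this
    refine ⟨μ, hμ, ?_⟩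
    rintro ⟨⟨u, v⟩, he⟩ z hz
    obtain ⟨-, h2, -⟩ := hψ u v he
    obtain ⟨x, hx⟩ : ∃ x, (u : α → ℝ) x ≠ (v : α → ℝ) x := by
      by_contra! h
      exact he.1 (Subtype.ext (funext h))
    have hxc := mem_edgeComponent he hx
    rw [← hμ.congr x z (inCommonCircuit_of_mem_component (edgeComponent _).2.1 hxc hz)]
    have h3 := congrFun h2 x
    rw [hψb, hψb] at h3
    simp only [add_sub_add_right_eq_sub, Pi.sub_apply, Pi.mul_apply, Pi.smul_apply,
      smul_eq_mul, Pi.add_apply, ← mul_sub] at h3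
    exact (mul_right_cancel₀ (sub_ne_zero.2 hx.symm) h3).symm
  · rintro ⟨μ, hμ, hl⟩
    -- Every coordinate that changes along an edge lies in the component of that edge, where `μ` is
    -- the edge factor.
    refine ⟨fun v => μ * (v : α → ℝ), fun u v h => ⟨?_, ?_, fun huv => ?_⟩⟩
    · obtain ⟨x, hx⟩ := component_nonempty (edgeComponent ⟨s(u, v), h⟩).2.1
      exact hl _ x hx ▸ hμ.nonneg x
    · ext z
      by_cases hz : (u : α → ℝ) z = (v : α → ℝ) z
      · simp [hz]
      · simp [hl _ z (mem_edgeComponent h hz), mul_sub]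
    · exact absurd (Subtype.ext huv) h.1

/-- The edge vector of a nontrivial component. -/
noncomputable def componentRay [Finite α] (S : nontrivialComponents M) :
    (polytopeGraph (basePolytope M)).edgeSet → ℝ :=
  open Classical in fun e => if edgeComponent e = S then 1 else 0

/-- The rays have disjoint supports, nonempty because each nontrivial component carries an edge. -/
lemma linearIndependent_componentRay [Finite α] :
    LinearIndependent ℝ (componentRay (M := M)) := by
  classical
  have := Fintype.ofFinite (nontrivialComponents M)
  rw [Fintype.linearIndependent_iff]
  intro g hg S
  obtain ⟨e, rfl⟩ := edgeComponent_surjective S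
  simpa [componentRay] using congrFun hg e

lemma hull_range_componentRay [Finite α] :
    PointedCone.hull ℝ (range (componentRay (M := M))) = deformationCone (basePolytope M) := by
  classical
  have := Fintype.ofFinite (nontrivialComponents M)
  apply le_antisymm
  · refine Submodule.span_le.2 ?_
    rintro _ ⟨S, rfl⟩
    refine mem_deformationCone_iff.2 ⟨_, isWeight_component S.2.1, fun e z hz => ?_⟩
    by_cases h : edgeComponent e = S
    · simp [componentRay, h, h ▸ hz]
    · have : z ∉ (S : Set α) := fun hzS =>
        h (Subtype.ext (component_eq_of_mem (edgeComponent e).2.1 S.2.1 hz hzS))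
      simp [componentRay, h, this]
  · intro l hl
    obtain ⟨μ, hμ, hlμ⟩ := mem_deformationCone_iff.1 hl
    choose x hx using fun S : nontrivialComponents M => component_nonempty S.2.1
    have : l = ∑ S, (⟨μ (x S), hμ.nonneg _⟩ : {c : ℝ // 0 ≤ c}) • componentRay S := by
      ext e
      simp [componentRay, Finset.sum_apply, Nonneg.mk_smul, hlμ e _ (hx (edgeComponent e))]
    rw [this]
    exact Submodule.sum_mem _ fun S _ =>
      Submodule.smul_mem _ _ (Submodule.subset_span (mem_range_self S))

theorem isSimplicial_deformationCone [Finite α] :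
    (deformationCone (basePolytope M)).IsSimplicial :=
  ⟨_, finite_range _, linearIndependent_componentRay.linearIndepOn_id, hull_range_componentRay⟩

theorem coneDim_deformationCone [Finite α] :
    coneDim (deformationCone (basePolytope M)) = (nontrivialComponents M).ncard := by
  have := Fintype.ofFinite (nontrivialComponents M)
  rw [coneDim, ← hull_range_componentRay, PointedCone.hull, Submodule.span_span_of_tower,
    finrank_span_eq_card linearIndependent_componentRay, ← Nat.card_eq_fintype_card,
    Nat.card_coe_set_eq]

end DeformationCone

end MatroidPolytopes

/-! ### The main theorem. -/

open MatroidPolytopes in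
theorem mainTheorem7 {α : Type*} [Finite α] (M : Matroid α) :
    -- a connected matroid has an indecomposable base polytope
    (IsConnected M → IsIndecomposable (basePolytope M)) ∧
    -- characterization of indecomposability
    (IsIndecomposable (basePolytope M) ↔ IsConnected (strip M)) ∧
    -- the deformation cone
    (deformationCone (basePolytope M)).IsSimplicial ∧
    coneDim (deformationCone (basePolytope M)) = (nontrivialComponents M).ncard ∧
    -- the decomposition into indecomposable polytopes
    basePolytope M = ∑ᶠ S ∈ components M, basePolytope (M.restrict S) ∧
    (∀ S ∈ components M, IsIndecomposable (basePolytope (M.restrict S)) ∧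
      ((basePolytope (M.restrict S)).Nontrivial ↔ S ∈ nontrivialComponents M)) ∧
    -- its uniqueness, up to translations and points
    (∀ (n : ℕ) (R : Fin n → Set (α → ℝ)),
      (∀ i, IsIndecomposable (R i) ∧ (R i).Nontrivial) →
      (∀ i j, i ≠ j → ¬ ∃ l : ℝ, 0 < l ∧ ∃ t : α → ℝ, R i = l • R j + {t}) →
      basePolytope M = ∑ i, R i →
      ∃ e : Fin n ≃ nontrivialComponents M,
        ∀ i, ∃ t : α → ℝ, R i = basePolytope (M.restrict (e i)) + {t}) ∧
    -- the deformations up to normal equivalence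
    (∀ Q : Set (α → ℝ), IsDeformation Q (basePolytope M) →
      ∃ A : Set (Set α), A ⊆ components M ∧
        NormallyEquivalent Q (∑ᶠ S ∈ A, basePolytope (M.restrict S))) := by
  have hcomp : ∀ S ∈ components M, IsIndecomposable (basePolytope (M.restrict S)) ∧
      ((basePolytope (M.restrict S)).Nontrivial ↔ S ∈ nontrivialComponents M) := fun _ hS =>
    ⟨isIndecomposable_basePolytope (isConnected_restrict hS),
      nontrivial_basePolytope_restrict_iff hS⟩
  exact ⟨isIndecomposable_basePolytope, isIndecomposable_basePolytope_iff,
    isSimplicial_deformationCone, coneDim_deformationCone, basePolytope_eq_finsum, hcomp,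
    exists_equiv_nontrivialComponents, fun _ hQ => hQ.exists_normallyEquivalent⟩
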